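/- Let $\Gamma\in\mathbb R^{n\times n}$ be symmetric positive definite (the prior covariance), let $G\in\mathbb R^{m\times n}$ (the noise-weighted linearized parameter-to-observation map) and let $0\ne g\in\mathbb R^n$ (the gradient). Put $A=G\Gamma^{1/2}$ and $H=A^\top A$, with eigenvalues $\lambda_1\ge\dots\ge\lambda_n\ge 0$ (and $\lambda_j=0$ for $j>n$). The Gauss–Newton Hessian is $\mathcal H=\Gamma^{-1}+G^\top G=\Gamma^{-1/2}(I+H)\Gamma^{-1/2}$, and the Gauss–Newton step $\delta x$ solves $\mathcal H\,\delta x=-g$. Let $r\ge 0$ be the target rank, $p\ge 2$ the oversampling parameter and $\ell=r+p$, and let $\Omega\in\mathbb R^{n\times\ell}$ be a standard Gaussian random matrix (independent $N(0,1)$ entries). Let $\widehat H$ be the output of the Nyström algorithm in exact arithmetic: $Y=H\Omega$; $LL^\top=\Omega^\top Y$ is a (lower triangular) Cholesky factorization; $W=L^{\dagger}Y^\top=\widehat U\widehat\Sigma\widehat V^\top$ is a thin SVD (where $L^\dagger$ is the Moore–Penrose inverse, equal to $L^{-1}$ when $\Omega^\top Y$ is invertible); and $\widehat H=\widehat V\widehat\Lambda\widehat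 V^\top$, where $\widehat\Lambda=\widehat\Sigma^2$ is truncated to its $k$ largest entries for some fixed $k\ge r$. For $k\ge\ell$ there is no truncation and $\widehat H=H\Omega(\Omega^\top H\Omega)^\dagger(H\Omega)^\top$. Put $\widehat{\mathcal H}=\Gamma^{-1/2}(I+\widehat H)\Gamma^{-1/2}$ and let $\delta\widehat x$ solve $\widehat{\mathcal H}\,\delta\widehat x=-g$. Write $\|x\|_{\Gamma^{-1}}=\|\Gamma^{-1/2}x\|_2$, $\kappa_2(M)=\|M\|_2\|M^{-1}\|_2$ and $$\Psi_H(r,p)=\lambda_{r+1}+\frac{r}{p-1}\sum_{j>r}\lambda_j .$$ Then both random variables below are integrable, and $$\mathbb E\left[\frac{\|\delta x-\delta\widehat x\|_{\Gamma^{-1}}}{\|\delta x\|_{\Gamma^{-1}}}\right]\le\Psi_H(r,p),\qquad \mathbb E\left[\kappa_2\big((I+\widehat H)^{-1/2}(I+H)(I+\widehat H)^{-1/2}\big)\right]\le 1+\Psi_H(r,p).$$ -/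

import Mathlib

open MeasureTheory ProbabilityTheory
open scoped Matrix MatrixOrder Matrix.Norms.L2Operator

namespace GNSketch

noncomputable section

/-! ### Norms and condition number

The norm `‖M‖` of a matrix is the operator norm induced by the Euclidean norms
(`Matrix.Norms.L2Operator`); `CFC.sqrt M` is the positive semidefinite square root of a positive
semidefinite matrix `M`. -/

/-- The 2-norm condition number `κ₂(M) = ‖M‖₂ ‖M⁻¹‖₂` (for invertible `M`). -/
def cond {n : ℕ} (M : Matrix (Fin n) (Fin n) ℝ) : ℝ := ‖M‖ * ‖M⁻¹‖

/-- The weighted norm `‖x‖_M = ‖M^{1/2} x‖₂` for positive definite `M`. -/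
def wnorm {n : ℕ} (M : Matrix (Fin n) (Fin n) ℝ) (x : Fin n → ℝ) : ℝ :=
  ‖WithLp.toLp 2 (CFC.sqrt M *ᵥ x)‖

/-! ### The Gauss–Newton system -/

/-- The prior-preconditioned forward operator `A = G Γ^{1/2}`. -/
def forwardOp {m n : ℕ} (Γ : Matrix (Fin n) (Fin n) ℝ) (G : Matrix (Fin m) (Fin n) ℝ) :
    Matrix (Fin m) (Fin n) ℝ := G * CFC.sqrt Γ

/-- The prior-preconditioned data-misfit Hessian `H = Aᵀ A`. -/
def misfitHessian {m n : ℕ} (Γ : Matrix (Fin n) (Fin n) ℝ) (G : Matrix (Fin m) (Fin n) ℝ) :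
    Matrix (Fin n) (Fin n) ℝ := (forwardOp Γ G)ᵀ * forwardOp Γ G

/-- The Gauss–Newton Hessian `Γ⁻¹ + Gᵀ G`. -/
def gnHessian {m n : ℕ} (Γ : Matrix (Fin n) (Fin n) ℝ) (G : Matrix (Fin m) (Fin n) ℝ) :
    Matrix (Fin n) (Fin n) ℝ := Γ⁻¹ + Gᵀ * G

/-- The approximate Gauss–Newton Hessian `Γ^{-1/2} (I + Ĥ) Γ^{-1/2}`. -/
def sketchedHessian {n : ℕ} (Γ Hhat : Matrix (Fin n) (Fin n) ℝ) : Matrix (Fin n) (Fin n) ℝ :=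
  (CFC.sqrt Γ)⁻¹ * (1 + Hhat) * (CFC.sqrt Γ)⁻¹

/-- The step `δx` solving `K δx = -g`, for an invertible (exact or approximate) Hessian `K`. -/
def gnStep {n : ℕ} (K : Matrix (Fin n) (Fin n) ℝ) (g : Fin n → ℝ) : Fin n → ℝ := -(K⁻¹ *ᵥ g)

/-- The preconditioned operator `(I + Ĥ)^{-1/2} (I + H) (I + Ĥ)^{-1/2}`. -/
def precondOp {n : ℕ} (H Hhat : Matrix (Fin n) (Fin n) ℝ) : Matrix (Fin n) (Fin n) ℝ :=
  (CFC.sqrt (1 + Hhat))⁻¹ * (1 + H) * (CFC.sqrt (1 + Hhat))⁻¹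

/-! ### Eigenvalues and the error bound -/

/-- The `j`-th largest eigenvalue `λ_j` (counted with multiplicity, `1 ≤ j ≤ n`) of a symmetric
`n × n` matrix; it is `0` for indices `j` outside this range. -/
def eig {n : ℕ} (H : Matrix (Fin n) (Fin n) ℝ) (j : ℕ) : ℝ :=
  open Classical in
  if h : H.IsHermitian ∧ 1 ≤ j ∧ j ≤ n then
    h.1.eigenvalues₀ ⟨j - 1, by rw [Fintype.card_fin]; omega⟩
  else 0

/-- `Ψ_H(r,p) = λ_{r+1} + r / (p - 1) * ∑_{j > r} λ_j`. -/
def Psi {n : ℕ} (H : Matrix (Fin n) (Fin n) ℝ) (r p : ℕ) : ℝ :=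
  eig H (r + 1) + (r : ℝ) / ((p : ℝ) - 1) * ∑ j ∈ Finset.Ioc r n, eig H j

/-! ### The Nyström sketch -/

/-- `X` is the Moore–Penrose inverse of `M`. -/
structure IsMoorePenrose {a b : ℕ} (M : Matrix (Fin a) (Fin b) ℝ)
    (X : Matrix (Fin b) (Fin a) ℝ) : Prop where
  mul_mul : M * X * M = M
  mul_mul' : X * M * X = X
  symm_left : (M * X)ᵀ = M * X
  symm_right : (X * M)ᵀ = X * M

/-- `Ĥ` is an output of the Nyström algorithm in exact arithmetic (where the stabilising shift, a
multiple of the machine epsilon, is zero) with input `H`, test matrix `Ω` and truncation of the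
thin SVD at rank `k` (for `k ≥ ℓ` there is no truncation):

* `Y = H Ω` and `C = Ωᵀ Y`;
* `L` is a lower triangular Cholesky factor of `(C + Cᵀ) / 2`;
* `W = L⁻¹ Yᵀ = U Σ Vᵀ` is a thin SVD, with singular values `σ` in decreasing order;
* `Ĥ = V Λ Vᵀ`, where `Λ` contains the squares of the `k` leading singular values.

If `C` is singular then `L⁻¹` is replaced by the Moore–Penrose inverse of `L`, which is `L⁻¹` if
`C` is invertible. -/
def IsNystromOutput {n ℓ : ℕ} (H : Matrix (Fin n) (Fin n) ℝ) (Om : Matrix (Fin n) (Fin ℓ) ℝ)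
    (k : ℕ) (Hhat : Matrix (Fin n) (Fin n) ℝ) : Prop :=
  ∃ (Y : Matrix (Fin n) (Fin ℓ) ℝ) (C L Ldag : Matrix (Fin ℓ) (Fin ℓ) ℝ)
    (U : Matrix (Fin ℓ) (Fin (min ℓ n)) ℝ) (σ : Fin (min ℓ n) → ℝ)
    (V : Matrix (Fin n) (Fin (min ℓ n)) ℝ),
    Y = H * Om ∧ C = Omᵀ * Y ∧
    (∀ i j, i < j → L i j = 0) ∧ (∀ i, 0 ≤ L i i) ∧ L * Lᵀ = (1 / 2 : ℝ) • (C + Cᵀ) ∧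
    IsMoorePenrose L Ldag ∧
    Uᵀ * U = 1 ∧ Vᵀ * V = 1 ∧ Antitone σ ∧ (∀ i, 0 ≤ σ i) ∧
    Ldag * Yᵀ = U * Matrix.diagonal σ * Vᵀ ∧
    Hhat = V * Matrix.diagonal (fun i : Fin (min ℓ n) => if (i : ℕ) < k then σ i ^ 2 else 0) * Vᵀ

/-- The entries of the random matrix `Om` are independent standard normal variables. -/
def IsStandardGaussian {S : Type*} [MeasurableSpace S] (P : Measure S) {n ℓ : ℕ}
    (Om : S → Matrix (Fin n) (Fin ℓ) ℝ) : Prop :=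
  (∀ i j, HasLaw (fun s => Om s i j) (gaussianReal 0 1) P) ∧
    iIndepFun (fun (ij : Fin n × Fin ℓ) (s : S) => Om s ij.1 ij.2) P

/-! ### Agreement with the closed formula -/

theorem IsMoorePenrose.unique {a b : ℕ} {M : Matrix (Fin a) (Fin b) ℝ}
    {X Z : Matrix (Fin b) (Fin a) ℝ} (hX : IsMoorePenrose M X) (hZ : IsMoorePenrose M Z) :
    X = Z := by
  have h1 : M * X = M * Z := by
    calc M * X = (M * X)ᵀ := hX.symm_left.symm
      _ = ((M * Z) * (M * X))ᵀ := by
        rw [← Matrix.mul_assoc, hZ.mul_mul]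
      _ = (M * X) * (M * Z) := by
        rw [Matrix.transpose_mul, hX.symm_left, hZ.symm_left]
      _ = M * Z := by rw [← Matrix.mul_assoc, hX.mul_mul]
  have h2 : X * M = Z * M := by
    calc X * M = (X * M)ᵀ := hX.symm_right.symm
      _ = ((X * M) * (Z * M))ᵀ := by
        rw [Matrix.mul_assoc, ← Matrix.mul_assoc M, hZ.mul_mul]
      _ = (Z * M) * (X * M) := by
        rw [Matrix.transpose_mul, hX.symm_right, hZ.symm_right]
      _ = Z * M := by rw [Matrix.mul_assoc, ← Matrix.mul_assoc M, hX.mul_mul]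
  calc X = X * M * X := hX.mul_mul'.symm
    _ = Z * (M * X) := by rw [h2, Matrix.mul_assoc]
    _ = Z := by rw [h1, ← Matrix.mul_assoc, hZ.mul_mul']

/-- Without truncation, the output of the algorithm is the Nyström approximation
`Ĥ = Y (Ωᵀ Y)† Yᵀ` with `Y = H Ω`. -/
theorem IsNystromOutput.eq_formula {n ℓ k : ℕ} {H Hhat : Matrix (Fin n) (Fin n) ℝ}
    {Om : Matrix (Fin n) (Fin ℓ) ℝ} (hH : Hᵀ = H) (hk : ℓ ≤ k)
    (h : IsNystromOutput H Om k Hhat) {Cdag : Matrix (Fin ℓ) (Fin ℓ) ℝ}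
    (hC : IsMoorePenrose (Omᵀ * (H * Om)) Cdag) :
    Hhat = (H * Om) * Cdag * (H * Om)ᵀ := by
  obtain ⟨Y, C, L, X, U, σ, V, rfl, rfl, -, -, hL, hX, hU, -, -, -, hW, rfl⟩ := h
  have hsym : (Omᵀ * (H * Om))ᵀ = Omᵀ * (H * Om) := by
    simp [Matrix.transpose_mul, hH, Matrix.mul_assoc]
  have hL' : L * Lᵀ = Omᵀ * (H * Om) := by
    rw [hL, hsym, ← two_smul ℝ, smul_smul]; norm_num
  have e1 : Lᵀ * Xᵀ = X * L := by rw [← Matrix.transpose_mul, hX.symm_right]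
  have e2 : Xᵀ * Lᵀ = L * X := by rw [← Matrix.transpose_mul, hX.symm_left]
  have f1 : L * Lᵀ * (Xᵀ * X) = L * X := by
    calc L * Lᵀ * (Xᵀ * X) = L * (Lᵀ * Xᵀ) * X := by simp only [Matrix.mul_assoc]
      _ = (L * X * L) * X := by rw [e1]; simp only [Matrix.mul_assoc]
      _ = L * X := by rw [hX.mul_mul]
  have f2 : Xᵀ * X * (L * Lᵀ) = L * X := by
    calc Xᵀ * X * (L * Lᵀ) = (L * Lᵀ * (Xᵀ * X))ᵀ := by
          simp only [Matrix.transpose_mul, Matrix.transpose_transpose]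
      _ = L * X := by rw [f1, hX.symm_left]
  have hmp : IsMoorePenrose (Omᵀ * (H * Om)) (Xᵀ * X) := by
    rw [← hL']
    refine ⟨?_, ?_, ?_, ?_⟩
    · rw [f1, ← Matrix.mul_assoc, hX.mul_mul]
    · rw [f2]
      calc L * X * (Xᵀ * X) = Xᵀ * (Lᵀ * Xᵀ) * X := by
            rw [← e2]; simp only [Matrix.mul_assoc]
        _ = Xᵀ * X := by
            rw [e1, Matrix.mul_assoc, hX.mul_mul']
    · rw [f1, hX.symm_left]
    · rw [f2, hX.symm_left]
  rw [hC.unique hmp]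
  have hd : (Matrix.diagonal (fun i : Fin (min ℓ n) => if (i : ℕ) < k then σ i ^ 2 else 0))
      = Matrix.diagonal σ * Matrix.diagonal σ := by
    rw [Matrix.diagonal_mul_diagonal]
    congr 1
    funext i
    have : (i : ℕ) < k := by have := i.2; omega
    simp [this, sq]
  have hWW : H * Om * (Xᵀ * X) * (H * Om)ᵀ = (X * (H * Om)ᵀ)ᵀ * (X * (H * Om)ᵀ) := by
    simp only [Matrix.transpose_mul, Matrix.transpose_transpose, Matrix.mul_assoc]
  rw [hWW, hW, hd]
  have hR : (U * Matrix.diagonal σ * Vᵀ)ᵀ * (U * Matrix.diagonal σ * Vᵀ)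
      = V * Matrix.diagonal σ * (Uᵀ * U) * (Matrix.diagonal σ * Vᵀ) := by
    simp only [Matrix.transpose_mul, Matrix.transpose_transpose, Matrix.diagonal_transpose,
      Matrix.mul_assoc]
  rw [hR, hU, Matrix.mul_one]
  simp only [Matrix.mul_assoc]

end

end GNSketch

namespace GNSketch

noncomputable section

/-! Both quantities are controlled by `‖H - Ĥ‖` once `0 ≤ Ĥ ≤ H` in the Loewner order: the resolvent
identity bounds the relative error by it (`relErr_le`), and the preconditioned operator is the
identity plus a positive semidefinite matrix of at most that norm (`cond_precondOp_le`). What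
remains is that the mean of `‖H - Ĥ‖` is at most `Ψ` (`lintegral_error_le_Psi`).

Deterministic part (`IsNystromOutput.error_bound`). `Ĥ` truncates `AᵀQA`, where `Q` projects onto
the range of `AΩ`. Let `W` hold the `r` leading eigenvectors of `H`, let `Z` be the first `r` rows
of `V₀ᵀΩ`, and let `ZX = 1`. Since `1 - Q` kills `AΩX`, passing from `H` to `AᵀQA` loses on `W` at
most `F = ‖A(W - ΩX)‖_F²`, which is the sum over `j > r` of `λ_j` times the squared norm of row `j`
of `V₀ᵀΩX`. By Ky Fan's principle the rank-`r` truncation `T` therefore has trace at least `λ₁ + … +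
λ_r - F`. For a unit vector `x`, project by `P` onto the span of `x` and the vectors retained in
`T`. Then `xᵀ(H - T)x ≤ tr(PH) - tr T`, and Ky Fan again, now for trace at most `r + 1`, gives
`λ_{r+1} + F`. Working with traces, the truncation costs no extra term.

Probabilistic part. `V₀ᵀΩ` is again standard Gaussian, and its rows beyond the first `r` are
independent of `Z`. With `X = Zᵀ(ZZᵀ)⁻¹`, the mean of `F` reduces to the diagonal of `(ZZᵀ)⁻¹`. Each
of its `r` entries is dominated by an inverse chi-square variable with `ℓ - r + 1` degrees of
freedom, whose mean is `1/(ℓ - r - 1) = 1/(p - 1)`. -/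

/-! ### Standard Gaussian vectors and resampling of a coordinate -/

/-- The law of a family of independent standard normal variables. -/
def stdNormal (ι : Type*) [Fintype ι] : Measure (ι → ℝ) := Measure.pi fun _ => gaussianReal 0 1

instance {ι : Type*} [Fintype ι] : IsProbabilityMeasure (stdNormal ι) := by
  unfold stdNormal; infer_instance

theorem stdNormal_map_toLp (ι : Type*) [Fintype ι] :
    (stdNormal ι).map (WithLp.toLp 2) = stdGaussian (EuclideanSpace ℝ ι) :=
  map_pi_eq_stdGaussian

/-- In finite dimension a linear map preserving the sum of squares is an orthogonal transformation,
and the standard Gaussian measure is invariant under these. -/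
theorem stdNormal_map_linear {ι : Type*} [Fintype ι] (f : (ι → ℝ) →ₗ[ℝ] (ι → ℝ))
    (hf : ∀ x, ∑ i, f x i ^ 2 = ∑ i, x i ^ 2) : (stdNormal ι).map f = stdNormal ι := by
  let F : EuclideanSpace ℝ ι →ₗᵢ[ℝ] EuclideanSpace ℝ ι :=
    { toLinearMap := (WithLp.linearEquiv 2 ℝ (ι → ℝ)).symm.toLinearMap ∘ₗ f ∘ₗ
        (WithLp.linearEquiv 2 ℝ (ι → ℝ)).toLinearMap
      norm_map' := fun x => by
        rw [EuclideanSpace.norm_eq, EuclideanSpace.norm_eq]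
        simpa using congrArg Real.sqrt (hf x.ofLp) }
  let E := F.toLinearIsometryEquiv rfl
  have h1 := stdGaussian_map E
  have hm : Measurable (WithLp.ofLp : EuclideanSpace ℝ ι → (ι → ℝ)) :=
    WithLp.measurable_ofLp 2 _
  have hm' : Measurable (WithLp.toLp 2 : (ι → ℝ) → EuclideanSpace ℝ ι) :=
    WithLp.measurable_toLp 2 _
  have hE : Measurable E := E.continuous.measurable
  have h2 : (stdNormal ι) = (stdGaussian (EuclideanSpace ℝ ι)).map WithLp.ofLp := by
    rw [← stdNormal_map_toLp, Measure.map_map hm hm']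
    exact Measure.map_id.symm
  have hfm : Measurable f := (LinearMap.continuous_of_finiteDimensional f).measurable
  conv_rhs => rw [h2, ← h1, ← stdNormal_map_toLp, Measure.map_map hE hm',
    Measure.map_map hm (hE.comp hm')]
  rfl

theorem lintegral_sq_dotProduct_stdNormal {ι : Type*} [Fintype ι] (a : ι → ℝ) :
    ∫⁻ z, ENNReal.ofReal ((∑ j, z j * a j) ^ 2) ∂(stdNormal ι)
      = ENNReal.ofReal (∑ j, a j ^ 2) := by
  have hm' : Measurable (WithLp.toLp 2 : (ι → ℝ) → EuclideanSpace ℝ ι) :=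
    WithLp.measurable_toLp 2 _
  let L : StrongDual ℝ (EuclideanSpace ℝ ι) := innerSL ℝ (WithLp.toLp 2 a)
  have hL : ∀ z : ι → ℝ, L (WithLp.toLp 2 z) = ∑ j, z j * a j := fun z => by
    simp [L, PiLp.inner_apply]
  have h0 : (stdGaussian (EuclideanSpace ℝ ι))[L] = 0 := integral_strongDual_stdGaussian L
  have hv := variance_dual_stdGaussian L
  have hmem : MemLp L 2 (stdGaussian (EuclideanSpace ℝ ι)) :=
    IsGaussian.memLp_dual _ L 2 (by norm_num)
  rw [variance_of_integral_eq_zero hmem.1.aemeasurable h0] at hv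
  have hn : ‖L‖ ^ 2 = ∑ j, a j ^ 2 := by
    simp [L, innerSL_apply_norm, EuclideanSpace.norm_sq_eq]
  rw [hn] at hv
  rw [← hv, ofReal_integral_eq_lintegral_ofReal hmem.integrable_sq
    (Filter.Eventually.of_forall fun x => by positivity), ← stdNormal_map_toLp,
    lintegral_map (by fun_prop) hm']
  simp only [hL]

/-- Redrawing one coordinate independently leaves a product measure unchanged. This stands in for
conditioning on all the other coordinates: in the inner integral they are frozen. -/
theorem lintegral_resample {ι : Type*} [Fintype ι] [DecidableEq ι] {X : Type*} [MeasurableSpace X]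
    (ν : Measure X) [IsProbabilityMeasure ν] (i : ι) {f : (ι → X) → ENNReal} (hf : Measurable f) :
    ∫⁻ ω, f ω ∂(Measure.pi fun _ : ι => ν) =
      ∫⁻ ω, ∫⁻ z, f (Function.update ω i z) ∂ν ∂(Measure.pi fun _ : ι => ν) := by
  have hu : Measurable fun q : (ι → X) × X => Function.update q.1 i q.2 := by
    refine measurable_pi_iff.2 fun j => ?_
    by_cases h : j = i
    · subst h; simpa using measurable_snd
    · simp only [Function.update_of_ne h]; fun_prop
  have hmap : ((Measure.pi fun _ : ι => ν).prod ν).map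
      (fun q : (ι → X) × X => Function.update q.1 i q.2) = Measure.pi fun _ : ι => ν := by
    refine (Measure.pi_eq fun s hs => ?_).symm
    rw [Measure.map_apply hu (MeasurableSet.univ_pi hs)]
    have : (fun q : (ι → X) × X => Function.update q.1 i q.2) ⁻¹' (Set.univ.pi s)
        = (Set.univ.pi (Function.update s i Set.univ)) ×ˢ (s i) := by
      ext q
      simp only [Set.mem_preimage, Set.mem_pi, Set.mem_univ, true_implies, Set.mem_prod]
      constructor
      · intro h
        refine ⟨fun j => ?_, by simpa using h i⟩
        by_cases hj : j = i
        · subst hj; simp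
        · simpa [Function.update_of_ne hj] using h j
      · rintro ⟨h1, h2⟩ j
        by_cases hj : j = i
        · subst hj; simpa using h2
        · simpa [Function.update_of_ne hj] using h1 j
    rw [this, Measure.prod_prod, Measure.pi_pi, ← Finset.mul_prod_erase _ _ (Finset.mem_univ i),
      ← Finset.mul_prod_erase _ (fun j => ν (s j)) (Finset.mem_univ i)]
    simp only [Function.update_self, measure_univ, one_mul]
    rw [mul_comm]
    congr 1
    refine Finset.prod_congr rfl fun j hj => ?_
    rw [Function.update_of_ne (Finset.ne_of_mem_erase hj)]
  conv_lhs => rw [← hmap, lintegral_map hf hu]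
  exact lintegral_prod _ (hf.comp hu).aemeasurable

/-! ### The mean of an inverse chi-square variable -/

open Filter Topology Set in
theorem lintegral_one_add_two_mul_rpow {d : ℝ} (hd : 2 < d) :
    ∫⁻ t in Ioi (0 : ℝ), ENNReal.ofReal ((1 + 2 * t) ^ (-(d / 2))) = ENNReal.ofReal (1 / (d - 2)) := by
  have hder : ∀ t ∈ Ici (0 : ℝ), HasDerivAt (fun t : ℝ => -(1 + 2 * t) ^ (1 - d / 2) / (d - 2))
      ((1 + 2 * t) ^ (-(d / 2))) t := by
    intro t ht
    have ht0 : (0 : ℝ) ≤ t := ht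
    have h1 : HasDerivAt (fun t : ℝ => 1 + 2 * t) 2 t := by
      simpa using ((hasDerivAt_id t).const_mul 2).const_add 1
    have h2 := (h1.rpow_const (p := 1 - d / 2) (Or.inl (by positivity))).neg.div_const (d - 2)
    refine h2.congr_deriv ?_
    have : 1 - d / 2 - 1 = -(d / 2) := by ring
    rw [this]
    have : d - 2 ≠ 0 := by linarith
    field_simp
    ring
  have hpos : ∀ t ∈ Ioi (0 : ℝ), 0 ≤ (1 + 2 * t) ^ (-(d / 2)) := fun t ht => by
    have : (0 : ℝ) < t := ht
    positivity
  have hlim : Tendsto (fun t : ℝ => -(1 + 2 * t) ^ (1 - d / 2) / (d - 2)) atTop (𝓝 0) := by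
    have h1 : Tendsto (fun t : ℝ => 1 + 2 * t) atTop atTop :=
      tendsto_atTop_add_const_left _ _ (tendsto_id.const_mul_atTop (by norm_num))
    have h2 := (tendsto_rpow_neg_atTop (y := d / 2 - 1) (by linarith)).comp h1
    have h3 := h2.neg.div_const (d - 2)
    simp only [neg_zero, zero_div] at h3
    refine h3.congr fun t => ?_
    simp [neg_sub]
  rw [← ofReal_integral_eq_lintegral_ofReal (integrableOn_Ioi_deriv_of_nonneg' hder hpos hlim)
    ((ae_restrict_iff' measurableSet_Ioi).2 (Eventually.of_forall hpos)),
    integral_Ioi_of_hasDerivAt_of_nonneg' hder hpos hlim]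
  congr 1
  simp
  ring

theorem lintegral_exp_neg_mul_sq_gaussianReal {t : ℝ} (ht : 0 < t) :
    ∫⁻ x, ENNReal.ofReal (Real.exp (-t * x ^ 2)) ∂(gaussianReal 0 1)
      = ENNReal.ofReal ((1 + 2 * t) ^ (-(1 / 2 : ℝ))) := by
  have hint : Integrable (fun x : ℝ => Real.exp (-t * x ^ 2)) (gaussianReal 0 1) := by
    refine Integrable.of_bound (C := 1) (by fun_prop) (Filter.Eventually.of_forall fun x => ?_)
    rw [Real.norm_eq_abs, abs_of_pos (Real.exp_pos _), Real.exp_le_one_iff]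
    nlinarith [sq_nonneg x]
  rw [← ofReal_integral_eq_lintegral_ofReal hint
    (Filter.Eventually.of_forall fun x => (Real.exp_pos _).le),
    integral_gaussianReal_eq_integral_smul one_ne_zero]
  congr 1
  have h1 : ∀ x : ℝ, gaussianPDFReal 0 1 x • Real.exp (-t * x ^ 2)
      = (√(2 * Real.pi))⁻¹ * Real.exp (-(t + 1 / 2) * x ^ 2) := fun x => by
    rw [gaussianPDFReal_def, smul_eq_mul, mul_assoc, ← Real.exp_add]
    simp only [NNReal.coe_one, mul_one, sub_zero]
    congr 2
    ring
  simp_rw [h1]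
  rw [integral_const_mul, integral_gaussian, Real.rpow_neg (by positivity), ← Real.sqrt_eq_rpow,
    ← Real.sqrt_inv, ← Real.sqrt_inv, ← Real.sqrt_mul (by positivity)]
  congr 1
  have := Real.pi_pos
  field_simp
  ring

-- At `q = 0` both sides are `⊤`, so the null event where a sum of squares vanishes needs no
-- exclusion later.
open Set in
theorem lintegral_exp_neg_mul {q : ℝ} (hq : 0 ≤ q) :
    ∫⁻ t in Ioi (0 : ℝ), ENNReal.ofReal (Real.exp (-t * q)) = (ENNReal.ofReal q)⁻¹ := by
  rcases hq.eq_or_lt with rfl | hq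
  · simp
  · have h : ∀ t : ℝ, Real.exp (-t * q) = Real.exp (-q * t) := fun t => by ring_nf
    simp_rw [h]
    rw [← ofReal_integral_eq_lintegral_ofReal (integrableOn_exp_mul_Ioi (by linarith) 0)
      (Filter.Eventually.of_forall fun x => (Real.exp_pos _).le), integral_exp_mul_Ioi (by linarith),
      ← ENNReal.ofReal_inv_of_pos hq]
    congr 1
    simp

open Set in
/-- The mean of the inverse of a chi-square variable with at least three degrees of freedom. -/
theorem lintegral_inv_sum_sq {ι : Type*} [Fintype ι] [DecidableEq ι] (s : Finset ι)
    (hs : 3 ≤ s.card) :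
    ∫⁻ x, (ENNReal.ofReal (∑ i ∈ s, x i ^ 2))⁻¹ ∂(stdNormal ι)
      = ENNReal.ofReal (1 / ((s.card : ℝ) - 2)) := by
  -- Writing `1/q` as the integral of `exp (-t q)` and applying Tonelli reduces the mean to the
  -- Laplace transform of `q`, which factors by independence into `(1 + 2t)^(-d/2)`.
  have h1 : ∀ x : ι → ℝ, (ENNReal.ofReal (∑ i ∈ s, x i ^ 2))⁻¹ =
      ∫⁻ t in Ioi (0 : ℝ), ∏ i ∈ s, ENNReal.ofReal (Real.exp (-t * x i ^ 2)) := fun x => by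
    rw [← lintegral_exp_neg_mul (Finset.sum_nonneg fun i _ => sq_nonneg _)]
    refine lintegral_congr fun t => ?_
    rw [← ENNReal.ofReal_prod_of_nonneg fun i _ => (Real.exp_pos _).le, ← Real.exp_sum,
      Finset.mul_sum]
  simp_rw [h1]
  rw [lintegral_lintegral_swap (Measurable.aemeasurable (by unfold Function.uncurry; fun_prop)),
    ← lintegral_one_add_two_mul_rpow (d := s.card) (by
      have : (3 : ℝ) ≤ s.card := by exact_mod_cast hs
      linarith)]
  refine setLIntegral_congr_fun measurableSet_Ioi fun t ht => ?_
  have ht0 : (0 : ℝ) < t := ht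
  have hm : Measurable fun y : ℝ => ENNReal.ofReal (Real.exp (-t * y ^ 2)) := by fun_prop
  have hind : iIndepFun (fun (i : ι) (x : ι → ℝ) => ENNReal.ofReal (Real.exp (-t * x i ^ 2)))
      (stdNormal ι) :=
    iIndepFun_pi (X := fun _ y => ENNReal.ofReal (Real.exp (-t * y ^ 2)))
      fun _ => hm.aemeasurable
  rw [lintegral_prod_eq_prod_lintegral_of_indepFun s _ hind (fun i => by fun_prop)]
  have h2 : ∀ i, ∫⁻ x, ENNReal.ofReal (Real.exp (-t * x i ^ 2)) ∂(stdNormal ι)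
      = ENNReal.ofReal ((1 + 2 * t) ^ (-(1 / 2 : ℝ))) := fun i => by
    rw [← lintegral_exp_neg_mul_sq_gaussianReal ht0]
    exact (measurePreserving_eval (fun _ : ι => gaussianReal 0 1) i).lintegral_comp hm
  simp_rw [h2]
  rw [Finset.prod_const, ← ENNReal.ofReal_pow (by positivity), ← Real.rpow_mul_natCast (by positivity)]
  congr 2
  ring

/-- The coordinates of a standard Gaussian vector in any orthonormal basis are again independent
standard normals. -/
theorem lintegral_inv_sum_sq_inner {ℓ : ℕ} (b : OrthonormalBasis (Fin ℓ) ℝ (EuclideanSpace ℝ (Fin ℓ)))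
    (s : Finset (Fin ℓ)) (hs : 3 ≤ s.card) :
    ∫⁻ z, (ENNReal.ofReal (∑ i ∈ s, (b i ⬝ᵥ z) ^ 2))⁻¹ ∂(stdNormal (Fin ℓ))
      = ENNReal.ofReal (1 / ((s.card : ℝ) - 2)) := by
  have hm' : Measurable (WithLp.toLp 2 : (Fin ℓ → ℝ) → EuclideanSpace ℝ (Fin ℓ)) :=
    WithLp.measurable_toLp 2 _
  have h : ∀ z : Fin ℓ → ℝ, ∀ i, b i ⬝ᵥ z = inner ℝ (b i) (WithLp.toLp 2 z) := fun z i => by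
    simp [PiLp.inner_apply, dotProduct, mul_comm]
  simp_rw [h]
  have hm : Measurable fun x : EuclideanSpace ℝ (Fin ℓ) =>
      (ENNReal.ofReal (∑ i ∈ s, (inner ℝ (b i) x) ^ 2))⁻¹ := by fun_prop
  rw [← lintegral_map hm hm', stdNormal_map_toLp, stdGaussian_eq_map_pi_orthonormalBasis b,
    lintegral_map hm (by fun_prop), ← lintegral_inv_sum_sq s hs]
  refine lintegral_congr fun x => ?_
  congr 2
  refine Finset.sum_congr rfl fun i _ => ?_
  rw [b.orthonormal.inner_right_fintype]

/-- Given fewer than `ℓ` vectors, part of an orthonormal basis is orthogonal to them. -/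
theorem exists_orthonormalBasis_orthogonal {ℓ d : ℕ} {κ : Type*} [Fintype κ]
    (w : κ → Fin ℓ → ℝ) (hd : Fintype.card κ + d ≤ ℓ) :
    ∃ (b : OrthonormalBasis (Fin ℓ) ℝ (EuclideanSpace ℝ (Fin ℓ))) (s : Finset (Fin ℓ)),
      s.card = d ∧ ∀ i ∈ s, ∀ j, b i ⬝ᵥ w j = 0 := by
  let E := EuclideanSpace ℝ (Fin ℓ)
  let K : Submodule ℝ E := Submodule.span ℝ (Set.range fun j => (WithLp.toLp 2 (w j) : E))
  have hK : Module.finrank ℝ K ≤ Fintype.card κ := finrank_range_le_card _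
  have hKo : Module.finrank ℝ K + Module.finrank ℝ Kᗮ = ℓ := by
    rw [K.finrank_add_finrank_orthogonal, finrank_euclideanSpace_fin]
  have hdK : d ≤ Module.finrank ℝ Kᗮ := by omega
  let u := stdOrthonormalBasis ℝ Kᗮ
  have hdl : d ≤ ℓ := by omega
  let v : Fin ℓ → E := fun i => if h : (i : ℕ) < d then (u ⟨i, by omega⟩ : E) else 0
  have hv : Orthonormal ℝ (({i : Fin ℓ | (i : ℕ) < d}).domRestrict v) := by
    have h1 : Orthonormal ℝ fun i => ((u i : Kᗮ) : E) :=
      u.orthonormal.comp_linearIsometry Kᗮ.subtypeₗᵢ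
    have h2 := h1.comp (fun i : {i : Fin ℓ | (i : ℕ) < d} =>
      (⟨i.1, lt_of_lt_of_le i.2 hdK⟩ : Fin (Module.finrank ℝ Kᗮ))) (fun i j hij => by
        exact Subtype.ext (Fin.ext (Fin.mk.inj hij)))
    convert h2 using 1
    funext i
    have : (i.1 : ℕ) < d := i.2
    simp [v, Set.domRestrict, this]
  obtain ⟨b, hb⟩ := hv.exists_orthonormalBasis_extension_of_card_eq
    (by rw [finrank_euclideanSpace])
  refine ⟨b, Finset.univ.filter fun i => (i : ℕ) < d, ?_, fun i hi j => ?_⟩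
  · rw [Fin.card_filter_val_lt]; omega
  · have hi' : (i : ℕ) < d := by simpa using hi
    have hmem : b i ∈ Kᗮ := by
      rw [hb i hi']; simp [v, hi']
    have := (Submodule.mem_orthogonal K _).1 hmem _ (Submodule.subset_span ⟨j, rfl⟩)
    rw [PiLp.inner_apply] at this
    simpa [dotProduct, mul_comm] using this

/-! ### Right inverses of Gaussian matrices -/

/-- The right inverse `Zᵀ (Z Zᵀ)⁻¹` of a matrix with linearly independent rows. -/
def rightInv {r ℓ : ℕ} (Z : Matrix (Fin r) (Fin ℓ) ℝ) : Matrix (Fin ℓ) (Fin r) ℝ :=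
  Zᵀ * (Z * Zᵀ)⁻¹

theorem transpose_inv_gram {r ℓ : ℕ} (Z : Matrix (Fin r) (Fin ℓ) ℝ) :
    ((Z * Zᵀ)⁻¹)ᵀ = (Z * Zᵀ)⁻¹ := by
  rw [Matrix.transpose_nonsing_inv, Matrix.transpose_mul, Matrix.transpose_transpose]

theorem sum_sq_rightInv {r ℓ : ℕ} (Z : Matrix (Fin r) (Fin ℓ) ℝ) (i : Fin r) :
    ∑ k, rightInv Z k i ^ 2 = (Z * Zᵀ)⁻¹ i i := by
  have h : (rightInv Z)ᵀ * rightInv Z = (Z * Zᵀ)⁻¹ := by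
    rw [rightInv, Matrix.transpose_mul, transpose_inv_gram, Matrix.transpose_transpose]
    by_cases hu : IsUnit (Z * Zᵀ).det
    · rw [Matrix.mul_assoc, ← Matrix.mul_assoc Z, Matrix.mul_nonsing_inv _ hu, Matrix.mul_one]
    · rw [Matrix.nonsing_inv_apply_not_isUnit _ hu, Matrix.mul_zero, Matrix.mul_zero]
  rw [← h, Matrix.mul_apply]
  exact Finset.sum_congr rfl fun k _ => by rw [Matrix.transpose_apply, sq]

/-- `Zᵀ(ZZᵀ)⁻¹eᵢ` is the minimum-norm solution of `Zx = eᵢ`, and its squared norm is the diagonal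
entry. A singular Gram matrix has inverse 0 by convention, which makes the bound trivial. -/
theorem inv_gram_apply_le {r ℓ : ℕ} (Z : Matrix (Fin r) (Fin ℓ) ℝ) (i : Fin r) {x : Fin ℓ → ℝ}
    (hx : Z *ᵥ x = Pi.single i 1) : (Z * Zᵀ)⁻¹ i i ≤ x ⬝ᵥ x := by
  by_cases hu : IsUnit (Z * Zᵀ).det
  · set c : Fin r → ℝ := (Z * Zᵀ)⁻¹ *ᵥ Pi.single i 1 with hc
    have hci : c i = (Z * Zᵀ)⁻¹ i i := by rw [hc, Matrix.mulVec_single_one]; rfl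
    have hxy : x ⬝ᵥ (Zᵀ *ᵥ c) = c i := by
      rw [Matrix.dotProduct_mulVec, Matrix.vecMul_transpose, hx, single_one_dotProduct]
    have hyy : (Zᵀ *ᵥ c) ⬝ᵥ (Zᵀ *ᵥ c) = c i := by
      rw [Matrix.dotProduct_mulVec, Matrix.vecMul_transpose, Matrix.mulVec_mulVec, hc,
        Matrix.mulVec_mulVec, Matrix.mul_nonsing_inv _ hu, Matrix.one_mulVec,
        single_one_dotProduct]
    have h0 : 0 ≤ (x - Zᵀ *ᵥ c) ⬝ᵥ (x - Zᵀ *ᵥ c) :=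
      Finset.sum_nonneg fun _ _ => mul_self_nonneg _
    rw [sub_dotProduct, dotProduct_sub, dotProduct_sub, dotProduct_comm (Zᵀ *ᵥ c) x, hxy, hyy] at h0
    linarith
  · rw [Matrix.nonsing_inv_apply_not_isUnit _ hu]
    exact Finset.sum_nonneg fun _ _ => mul_self_nonneg _

/-- Cramer's rule: each entry is a cofactor times the inverse determinant, and inversion on `ℝ` with
`0⁻¹ = 0` is measurable. -/
theorem measurable_inv_apply {α : Type*} [MeasurableSpace α] {r : ℕ}
    {M : α → Matrix (Fin r) (Fin r) ℝ} (hM : ∀ i j, Measurable fun a => M a i j) (i j : Fin r) :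
    Measurable fun a => (M a)⁻¹ i j := by
  have hdet : ∀ {N : α → Matrix (Fin r) (Fin r) ℝ}, (∀ i j, Measurable fun a => N a i j) →
      Measurable fun a => (N a).det := fun hN => by
    simp_rw [Matrix.det_apply]
    refine Finset.measurable_sum _ fun σ _ => ?_
    exact (Finset.measurable_prod _ fun i _ => hN _ _).const_smul _
  simp_rw [Matrix.inv_def, Matrix.smul_apply, Matrix.adjugate_apply, Ring.inverse_eq_inv',
    smul_eq_mul]
  refine (hdet hM).inv.mul (hdet fun k l => ?_)
  by_cases h : k = j
  · subst h; simp
  · simpa [Matrix.updateRow_ne h] using hM k l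

/-- The first `r` rows of a matrix given by its rows. -/
def topRows {n r ℓ : ℕ} (h : r ≤ n) (ω : Fin n → Fin ℓ → ℝ) : Matrix (Fin r) (Fin ℓ) ℝ :=
  Matrix.of fun i => ω (Fin.castLE h i)

/-- The law of the rows of an `n × ℓ` standard Gaussian matrix. -/
def gaussianRows (n ℓ : ℕ) : Measure (Fin n → Fin ℓ → ℝ) :=
  Measure.pi fun _ => stdNormal (Fin ℓ)

instance {n ℓ : ℕ} : IsProbabilityMeasure (gaussianRows n ℓ) := by
  unfold gaussianRows; infer_instance

theorem measurable_gram_topRows {n r ℓ : ℕ} (h : r ≤ n) (i j : Fin r) :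
    Measurable fun ω : Fin n → Fin ℓ → ℝ => (topRows h ω * (topRows h ω)ᵀ) i j := by
  simp only [Matrix.mul_apply, topRows, Matrix.transpose_apply, Matrix.of_apply]
  fun_prop

theorem measurable_inv_gram_topRows {n r ℓ : ℕ} (h : r ≤ n) (i j : Fin r) :
    Measurable fun ω : Fin n → Fin ℓ → ℝ => (topRows h ω * (topRows h ω)ᵀ)⁻¹ i j :=
  measurable_inv_apply (measurable_gram_topRows h) i j

theorem measurable_rightInv_topRows {n r ℓ : ℕ} (h : r ≤ n) (k : Fin ℓ) (i : Fin r) :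
    Measurable fun ω : Fin n → Fin ℓ → ℝ => rightInv (topRows h ω) k i := by
  simp only [rightInv, Matrix.mul_apply (M := (topRows h _)ᵀ)]
  refine Finset.measurable_sum _ fun j _ => ?_
  refine Measurable.mul ?_ (measurable_inv_gram_topRows h j i)
  simp only [topRows, Matrix.transpose_apply, Matrix.of_apply]
  fun_prop

theorem isUnit_det_gram_iff {r ℓ : ℕ} (Z : Matrix (Fin r) (Fin ℓ) ℝ) :
    IsUnit (Z * Zᵀ).det ↔ LinearIndependent ℝ Z.row := by
  have h : ∀ {k : ℕ} (M : Matrix (Fin r) (Fin k) ℝ), LinearIndependent ℝ M.row ↔ r = M.rank :=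
    fun M => by
      rw [linearIndependent_iff_card_eq_finrank_span, Matrix.rank_eq_finrank_span_row,
        Fintype.card_fin]
      rfl
  rw [h, ← Matrix.rank_self_mul_transpose, ← h, Matrix.linearIndependent_rows_iff_isUnit,
    Matrix.isUnit_iff_isUnit_det]

/-- Induction on the rows, redrawing the last one. Three orthonormal directions orthogonal to the
earlier rows exist because `r + 1 + 2 ≤ ℓ`. The inverse sum of squares of the new row's components
along them has finite mean, so this sum is almost surely nonzero and the new row leaves the span of
the others. -/
theorem ae_linearIndependent_topRows {n ℓ : ℕ} (r : ℕ) (h : r ≤ n) (hℓ : r + 2 ≤ ℓ) :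
    ∀ᵐ ω ∂(gaussianRows n ℓ), LinearIndependent ℝ (topRows h ω).row := by
  induction r with
  | zero => exact Filter.Eventually.of_forall fun ω => linearIndependent_empty_type
  | succ r ih =>
    have ih' := ih (by omega) (by omega)
    set S : Set (Fin n → Fin ℓ → ℝ) := {ω | ¬ LinearIndependent ℝ (topRows h ω).row} with hS
    have hSm : MeasurableSet S := by
      have : S = {ω | (topRows h ω * (topRows h ω)ᵀ).det = 0} := by
        ext ω
        simp only [hS, Set.mem_ofPred_eq, ← isUnit_det_gram_iff, isUnit_iff_ne_zero, not_not]
      rw [this]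
      refine measurableSet_eq_fun ?_ measurable_const
      simp_rw [Matrix.det_apply]
      exact Finset.measurable_sum _ fun σ _ =>
        (Finset.measurable_prod _ fun i _ => measurable_gram_topRows h _ _).const_smul _
    have h0 : ∫⁻ ω, S.indicator 1 ω ∂(gaussianRows n ℓ) = 0 := by
      rw [gaussianRows, lintegral_resample _ (Fin.castLE h (Fin.last r))
        (measurable_one.indicator hSm)]
      refine (lintegral_eq_zero_of_ae_eq_zero ?_)
      filter_upwards [ih'] with ω hω
      refine lintegral_eq_zero_of_ae_eq_zero ?_
      obtain ⟨b, s, hs, hb⟩ := exists_orthonormalBasis_orthogonal (d := 3)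
        (fun j : Fin r => ω (Fin.castLE (by omega) j)) (by rw [Fintype.card_fin]; omega)
      have hfin : ∫⁻ z, (ENNReal.ofReal (∑ i ∈ s, (b i ⬝ᵥ z) ^ 2))⁻¹ ∂(stdNormal (Fin ℓ)) ≠ ⊤ := by
        rw [lintegral_inv_sum_sq_inner b s hs.ge]; exact ENNReal.ofReal_ne_top
      have hae := ae_lt_top (by simp only [dotProduct]; fun_prop) hfin
      filter_upwards [hae] with z hz
      refine Set.indicator_of_notMem ?_ _
      simp only [hS, Set.mem_ofPred_eq, not_not]
      rw [linearIndependent_finSucc']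
      have hne : ∀ j : Fin r, Fin.castLE h j.castSucc ≠ Fin.castLE h (Fin.last r) := fun j hj => by
        have := congrArg Fin.val hj
        simp at this
        omega
      have hinit : Fin.init (topRows h (Function.update ω (Fin.castLE h (Fin.last r)) z)).row
          = (topRows (by omega : r ≤ n) ω).row := by
        funext j
        exact Function.update_of_ne (hne j) z ω
      have hlast : (topRows h (Function.update ω (Fin.castLE h (Fin.last r)) z)).row (Fin.last r)
          = z := by
        change Function.update ω (Fin.castLE h (Fin.last r)) z (Fin.castLE h (Fin.last r)) = z
        exact Function.update_self ..
      rw [hinit, hlast]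
      refine ⟨hω, fun hz' => ?_⟩
      have hzero : ∀ i ∈ s, b i ⬝ᵥ z = 0 := fun i hi => by
        refine Submodule.span_induction (p := fun z _ => b i ⬝ᵥ z = 0) ?_ (by simp)
          (fun x y _ _ hx hy => by rw [dotProduct_add, hx, hy, add_zero])
          (fun a x _ hx => by rw [dotProduct_smul, hx, smul_zero]) hz'
        rintro x ⟨j, rfl⟩
        exact hb i hi j
      rw [Finset.sum_eq_zero fun i hi => by rw [hzero i hi]; ring] at hz
      simp at hz
    rw [lintegral_indicator_one hSm] at h0
    exact h0

/-- With the other `r - 1` rows frozen, the entry is at most `1/q`, where `q` is the squared length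
of the part of row `i` along `ℓ - r + 1` directions orthogonal to them. -/
theorem lintegral_inv_gram_le {n r ℓ : ℕ} (h : r ≤ n) (hℓ : r + 2 ≤ ℓ) (i : Fin r) :
    ∫⁻ ω, ENNReal.ofReal ((topRows h ω * (topRows h ω)ᵀ)⁻¹ i i) ∂(gaussianRows n ℓ)
      ≤ ENNReal.ofReal (1 / ((ℓ : ℝ) - r - 1)) := by
  rw [gaussianRows, lintegral_resample _ (Fin.castLE h i)
    (measurable_inv_gram_topRows h i i).ennreal_ofReal]
  refine (lintegral_mono fun ω => ?_).trans (lintegral_const _ |>.trans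
    (by rw [measure_univ, mul_one])).le
  obtain ⟨b, s, hs, hb⟩ := exists_orthonormalBasis_orthogonal (d := ℓ - r + 1)
    (fun j : {j : Fin r // j ≠ i} => ω (Fin.castLE h j)) (by
      have := i.pos
      rw [Fintype.card_subtype_compl, Fintype.card_fin, Fintype.card_subtype_eq]; omega)
  have h1 := lintegral_inv_sum_sq_inner b s (by omega)
  have hcard : (s.card : ℝ) - 2 = (ℓ : ℝ) - r - 1 := by
    rw [hs]; push_cast [Nat.cast_sub (by omega : r ≤ ℓ)]; ring
  rw [hcard] at h1
  rw [← h1]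
  refine lintegral_mono fun z => ?_
  set q := ∑ k ∈ s, (b k ⬝ᵥ z) ^ 2 with hq
  have hq0 : 0 ≤ q := Finset.sum_nonneg fun _ _ => sq_nonneg _
  rcases hq0.eq_or_lt with hq0 | hq0
  · rw [← hq0]; simp
  rw [← ENNReal.ofReal_inv_of_pos hq0]
  refine ENNReal.ofReal_le_ofReal ?_
  have hbb : ∀ k l, (b k : Fin ℓ → ℝ) ⬝ᵥ (b l : Fin ℓ → ℝ) = if k = l then 1 else 0 := fun k l => by
    rw [← orthonormal_iff_ite.1 b.orthonormal k l, PiLp.inner_apply]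
    simp [dotProduct, mul_comm]
  -- The projection of `z` onto the chosen directions, divided by its squared length `q`: it is
  -- orthogonal to the other rows, has inner product 1 with `z`, and has squared norm `1/q`.
  set x : Fin ℓ → ℝ := q⁻¹ • ∑ k ∈ s, (b k ⬝ᵥ z) • (b k : Fin ℓ → ℝ) with hx
  have hxw : ∀ w : Fin ℓ → ℝ, w ⬝ᵥ x = q⁻¹ * ∑ k ∈ s, (b k ⬝ᵥ z) * (b k ⬝ᵥ w) := fun w => by
    rw [hx, dotProduct_smul, dotProduct_sum, smul_eq_mul]
    congr 1
    exact Finset.sum_congr rfl fun k _ => by rw [dotProduct_smul, smul_eq_mul, dotProduct_comm w]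
  have hbx : ∀ k ∈ s, (b k : Fin ℓ → ℝ) ⬝ᵥ x = q⁻¹ * (b k ⬝ᵥ z) := fun k hk => by
    rw [hxw]
    simp [hbb, hk]
  have hxx : x ⬝ᵥ x = q⁻¹ := by
    rw [hxw, Finset.sum_congr rfl fun k hk => by rw [hbx k hk, mul_left_comm, ← sq], ← Finset.mul_sum,
      ← hq]
    field_simp
  rw [← hxx]
  refine inv_gram_apply_le _ i ?_
  funext j
  change Function.update ω (Fin.castLE h i) z (Fin.castLE h j) ⬝ᵥ x = _
  by_cases hj : j = i
  · subst hj
    rw [Function.update_self, hxw, Pi.single_eq_same]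
    simp_rw [← sq]
    rw [← hq, inv_mul_cancel₀ hq0.ne']
  · rw [Function.update_of_ne (fun h' => hj (Fin.castLE_injective h h')), hxw,
      Pi.single_eq_of_ne hj, Finset.sum_eq_zero fun k hk => by rw [hb k hk ⟨j, hj⟩, mul_zero],
      mul_zero]

/-- A row with index at least `r` does not enter the right inverse. Redrawing it replaces each
squared inner product by the squared norm of a column of the right inverse, a diagonal entry of the
inverse Gram matrix. -/
theorem lintegral_weighted_sum_sq_le {n r ℓ : ℕ} (h : r ≤ n) (hℓ : r + 2 ≤ ℓ) (d : Fin n → ℝ)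
    (hd : ∀ j, 0 ≤ d j) :
    ∫⁻ ω, ENNReal.ofReal (∑ j with r ≤ (j : Fin n).val, d j *
        ∑ i, (ω j ⬝ᵥ fun k => rightInv (topRows h ω) k i) ^ 2) ∂(gaussianRows n ℓ)
      ≤ ENNReal.ofReal ((r : ℝ) / ((ℓ : ℝ) - r - 1) * ∑ j with r ≤ (j : Fin n).val, d j) := by
  have hpos : (0 : ℝ) < (ℓ : ℝ) - r - 1 := by
    have : (r : ℝ) + 2 ≤ ℓ := by exact_mod_cast hℓ
    linarith
  have hm : ∀ (j : Fin n) (i : Fin r), Measurable fun ω : Fin n → Fin ℓ → ℝ =>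
      ENNReal.ofReal ((ω j ⬝ᵥ fun k => rightInv (topRows h ω) k i) ^ 2) := fun j i => by
    simp only [dotProduct]
    refine Measurable.ennreal_ofReal (Measurable.pow_const (Finset.measurable_sum _ fun k _ => ?_) 2)
    exact Measurable.mul (by fun_prop) (measurable_rightInv_topRows h k i)
  have hone : ∀ (j : Fin n) (i : Fin r), r ≤ j.val →
      ∫⁻ ω, ENNReal.ofReal ((ω j ⬝ᵥ fun k => rightInv (topRows h ω) k i) ^ 2) ∂(gaussianRows n ℓ)
        ≤ ENNReal.ofReal (1 / ((ℓ : ℝ) - r - 1)) := fun j i hj => by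
    rw [gaussianRows, lintegral_resample _ j (hm j i), ← gaussianRows]
    refine le_trans (le_of_eq (lintegral_congr fun ω => ?_)) (lintegral_inv_gram_le h hℓ i)
    have ht : ∀ z, topRows h (Function.update ω j z) = topRows h ω := fun z => by
      ext a b
      simp only [topRows, Matrix.of_apply]
      rw [Function.update_of_ne]
      intro hja
      have := congrArg Fin.val hja
      have := a.2
      simp at *
      omega
    simp only [ht, Function.update_self, dotProduct]
    rw [lintegral_sq_dotProduct_stdNormal, sum_sq_rightInv]
  have hsum : ∀ ω : Fin n → Fin ℓ → ℝ, ENNReal.ofReal (∑ j with r ≤ (j : Fin n).val, d j *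
        ∑ i, (ω j ⬝ᵥ fun k => rightInv (topRows h ω) k i) ^ 2)
      = ∑ j with r ≤ (j : Fin n).val, ENNReal.ofReal (d j) *
        ∑ i, ENNReal.ofReal ((ω j ⬝ᵥ fun k => rightInv (topRows h ω) k i) ^ 2) := fun ω => by
    rw [ENNReal.ofReal_sum_of_nonneg fun j _ =>
      mul_nonneg (hd j) (Finset.sum_nonneg fun _ _ => sq_nonneg _)]
    refine Finset.sum_congr rfl fun j _ => ?_
    rw [ENNReal.ofReal_mul (hd j), ENNReal.ofReal_sum_of_nonneg fun _ _ => sq_nonneg _]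
  simp_rw [hsum]
  rw [lintegral_finsetSum _ fun j _ => (Finset.measurable_sum _ fun i _ => hm j i).const_mul _]
  have hle : ∀ j ∈ Finset.univ.filter (fun j : Fin n => r ≤ j.val),
      ∫⁻ ω, ENNReal.ofReal (d j) * ∑ i, ENNReal.ofReal
        ((ω j ⬝ᵥ fun k => rightInv (topRows h ω) k i) ^ 2) ∂(gaussianRows n ℓ)
      ≤ ENNReal.ofReal (d j * ((r : ℝ) / ((ℓ : ℝ) - r - 1))) := fun j hj => by
    rw [lintegral_const_mul _ (Finset.measurable_sum _ fun i _ => hm j i),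
      lintegral_finsetSum _ fun i _ => hm j i, ENNReal.ofReal_mul (hd j)]
    gcongr
    refine (Finset.sum_le_sum fun i _ => hone j i (by simpa using hj)).trans ?_
    rw [Finset.sum_const, Finset.card_univ, Fintype.card_fin, nsmul_eq_mul, ← ENNReal.ofReal_natCast,
      ← ENNReal.ofReal_mul (by positivity), mul_one_div]
  refine (Finset.sum_le_sum hle).trans ?_
  rw [← ENNReal.ofReal_sum_of_nonneg fun j _ => mul_nonneg (hd j) (by positivity), Finset.mul_sum]
  exact le_of_eq (congrArg _ (Finset.sum_congr rfl fun j _ => mul_comm _ _))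

/-! ### Traces against projections and Ky Fan's principle -/

/-- The bathtub principle: after subtracting the threshold `t`, weight 1 is optimal below index `m`
and weight 0 from `m` on. -/
theorem sum_mul_le_of_threshold {N m : ℕ} (hm : m ≤ N) {d c : Fin N → ℝ} {t q : ℝ}
    (hc0 : ∀ j, 0 ≤ c j) (hc1 : ∀ j, c j ≤ 1) (hc : ∑ j, c j ≤ q) (ht : 0 ≤ t)
    (hlt : ∀ j : Fin N, j.val < m → t ≤ d j) (hge : ∀ j : Fin N, m ≤ j.val → d j ≤ t) :
    ∑ j, d j * c j ≤ ∑ j with (j : Fin N).val < m, d j + t * (q - m) := by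
  have h1 : ∑ j, (d j - t) * c j ≤ ∑ j with (j : Fin N).val < m, (d j - t) := by
    rw [Finset.sum_filter]
    refine Finset.sum_le_sum fun j _ => ?_
    split_ifs with h
    · nlinarith [hlt j h, hc1 j]
    · nlinarith [hge j (not_lt.1 h), hc0 j]
  have h2 : ∑ j, (d j - t) * c j = ∑ j, d j * c j - t * ∑ j, c j := by
    rw [Finset.mul_sum, ← Finset.sum_sub_distrib]
    exact Finset.sum_congr rfl fun j _ => by ring
  have h3 : ∑ j with (j : Fin N).val < m, (d j - t) = ∑ j with (j : Fin N).val < m, d j - m * t := by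
    rw [Finset.sum_sub_distrib, Finset.sum_const, Fin.card_filter_val_lt, min_eq_right hm,
      nsmul_eq_mul]
  nlinarith [mul_le_mul_of_nonneg_left hc ht]

theorem trace_transpose_mul_self_nonneg {a b : ℕ} (M : Matrix (Fin a) (Fin b) ℝ) :
    0 ≤ (Mᵀ * M).trace :=
  Finset.sum_nonneg fun i _ => by
    rw [Matrix.diag_apply, Matrix.mul_apply]
    exact Finset.sum_nonneg fun j _ => mul_self_nonneg _

theorem transpose_mul_self_apply_nonneg {a b : ℕ} (M : Matrix (Fin a) (Fin b) ℝ) (i : Fin b) :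
    0 ≤ (Mᵀ * M) i i := by
  rw [Matrix.mul_apply]
  exact Finset.sum_nonneg fun j _ => mul_self_nonneg _

theorem proj_compl {n : ℕ} {P : Matrix (Fin n) (Fin n) ℝ} (hs : Pᵀ = P) (hi : P * P = P) :
    (1 - P)ᵀ * (1 - P) = 1 - P := by
  rw [Matrix.transpose_sub, Matrix.transpose_one, hs, Matrix.sub_mul, Matrix.mul_sub P, hi]
  simp

/-- A weak form of Ky Fan's maximum principle. -/
theorem trace_proj_mul_le {n N m : ℕ} (hm : m ≤ N) {P : Matrix (Fin n) (Fin n) ℝ} (hs : Pᵀ = P)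
    (hi : P * P = P) {q : ℝ} (hq : P.trace ≤ q) {V : Matrix (Fin n) (Fin N) ℝ} (hV : Vᵀ * V = 1)
    {d : Fin N → ℝ} {t : ℝ} (ht : 0 ≤ t) (hlt : ∀ j : Fin N, j.val < m → t ≤ d j)
    (hge : ∀ j : Fin N, m ≤ j.val → d j ≤ t) :
    (P * (V * Matrix.diagonal d * Vᵀ)).trace
      ≤ ∑ j with (j : Fin N).val < m, d j + t * (q - m) := by
  have h1 : (P * (V * Matrix.diagonal d * Vᵀ)).trace = ∑ j, d j * (Vᵀ * P * V) j j := by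
    rw [← Matrix.mul_assoc, Matrix.trace_mul_comm, ← Matrix.mul_assoc, ← Matrix.mul_assoc]
    simp only [Matrix.trace, Matrix.diag_apply, Matrix.mul_diagonal]
    exact Finset.sum_congr rfl fun j _ => mul_comm _ _
  have hPV : Vᵀ * P * V = (P * V)ᵀ * (P * V) := by
    rw [Matrix.transpose_mul, hs, Matrix.mul_assoc, Matrix.mul_assoc, ← Matrix.mul_assoc P P, hi]
  have hPV' : 1 - Vᵀ * P * V = ((1 - P) * V)ᵀ * ((1 - P) * V) := by
    rw [Matrix.transpose_mul, Matrix.mul_assoc Vᵀ (1 - P)ᵀ, ← Matrix.mul_assoc _ (1 - P) V,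
      proj_compl hs hi, Matrix.sub_mul, Matrix.mul_sub, Matrix.one_mul, hV, ← Matrix.mul_assoc]
  rw [h1]
  -- The weights are the diagonal entries of `VᵀPV`. They lie in `[0, 1]` since `P` and `1 - P` are
  -- both positive semidefinite, and their sum is at most `tr P` because `VVᵀ` is a projection.
  refine sum_mul_le_of_threshold hm (fun j => ?_) (fun j => ?_) ?_ ht hlt hge
  · rw [hPV]; exact transpose_mul_self_apply_nonneg _ j
  · have := transpose_mul_self_apply_nonneg ((1 - P) * V) j
    rw [← hPV', Matrix.sub_apply, Matrix.one_apply_eq] at this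
    linarith
  · refine le_trans ?_ hq
    have hVs : (V * Vᵀ)ᵀ = V * Vᵀ := by rw [Matrix.transpose_mul, Matrix.transpose_transpose]
    have hVi : V * Vᵀ * (V * Vᵀ) = V * Vᵀ := by
      rw [Matrix.mul_assoc, ← Matrix.mul_assoc Vᵀ, hV, Matrix.one_mul]
    have h2 := trace_transpose_mul_self_nonneg ((1 - V * Vᵀ) * P)
    rw [Matrix.transpose_mul, Matrix.mul_assoc, ← Matrix.mul_assoc _ (1 - V * Vᵀ),
      proj_compl hVs hVi, Matrix.trace_mul_comm, hs, Matrix.mul_assoc, hi, Matrix.sub_mul,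
      Matrix.one_mul, Matrix.trace_sub, Matrix.mul_assoc, Matrix.trace_mul_comm] at h2
    change (Vᵀ * P * V).trace ≤ _
    linarith

/-- As `x = Px`, the entries of `Bx` are inner products of `x` with the projected rows of `B`.
Cauchy–Schwarz in each row yields the squared Frobenius norm of `BP`. -/
theorem mulVec_self_le_trace_proj {n a : ℕ} {P : Matrix (Fin n) (Fin n) ℝ} (hs : Pᵀ = P)
    (hi : P * P = P) (B : Matrix (Fin a) (Fin n) ℝ) {x : Fin n → ℝ} (hx : P *ᵥ x = x) :
    (B *ᵥ x) ⬝ᵥ (B *ᵥ x) ≤ (x ⬝ᵥ x) * (P * (Bᵀ * B)).trace := by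
  have h1 : (P * (Bᵀ * B)).trace = ∑ i, (P *ᵥ B i) ⬝ᵥ (P *ᵥ B i) := by
    have : (P * (Bᵀ * B)).trace = ((P * Bᵀ)ᵀ * (P * Bᵀ)).trace := by
      rw [Matrix.transpose_mul, hs, Matrix.transpose_transpose, Matrix.mul_assoc,
        ← Matrix.mul_assoc P P, hi, ← Matrix.mul_assoc P, Matrix.trace_mul_comm]
    rw [this]
    rfl
  rw [h1, Finset.mul_sum]
  refine Finset.sum_le_sum fun i _ => ?_
  have h2 : (B *ᵥ x) i = (P *ᵥ B i) ⬝ᵥ x := by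
    have h3 : (P *ᵥ B i) ⬝ᵥ x = B i ⬝ᵥ (Pᵀ *ᵥ x) := by
      rw [Matrix.dotProduct_mulVec, Matrix.vecMul_transpose]
    rw [h3, hs, hx]
    rfl
  rw [h2, mul_comm (x ⬝ᵥ x)]
  have := Finset.sum_mul_sq_le_sq_mul_sq Finset.univ (P *ᵥ B i) x
  simpa only [dotProduct, ← sq] using this

/-- A symmetric projection onto the span of orthonormal columns and one more vector. -/
theorem exists_proj {n r : ℕ} {V : Matrix (Fin n) (Fin r) ℝ} (hV : Vᵀ * V = 1) (x : Fin n → ℝ) :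
    ∃ P : Matrix (Fin n) (Fin n) ℝ, Pᵀ = P ∧ P * P = P ∧ P.trace ≤ (r : ℝ) + 1 ∧ P *ᵥ x = x ∧
      P * V = V := by
  set w : Fin n → ℝ := x - V *ᵥ (Vᵀ *ᵥ x) with hw
  have hVw : Vᵀ *ᵥ w = 0 := by
    rw [hw, Matrix.mulVec_sub, Matrix.mulVec_mulVec _ Vᵀ V, hV, Matrix.one_mulVec, sub_self]
  have hwV : w ᵥ* V = 0 := by rw [← Matrix.mulVec_transpose, hVw]
  have hwx : w ⬝ᵥ x = w ⬝ᵥ w := by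
    have : x = w + V *ᵥ (Vᵀ *ᵥ x) := by rw [hw]; abel
    conv_lhs => rw [this]
    rw [dotProduct_add, Matrix.dotProduct_mulVec, hwV, zero_dotProduct, add_zero]
  have hww : w ⬝ᵥ w = 0 → w = 0 := dotProduct_self_eq_zero.1
  -- If `x` already lies in the column span, then `w = 0` and `β = 0`: the rank-one term disappears,
  -- and the trace is `r` instead of `r + 1`.
  set β := (w ⬝ᵥ w)⁻¹ with hβ
  have hβw : (β * (w ⬝ᵥ w)) • w = w := by
    by_cases h : w ⬝ᵥ w = 0
    · rw [hww h]; simp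
    · rw [hβ, inv_mul_cancel₀ h, one_smul]
  have hz : Matrix.vecMulVec w (0 : Fin r → ℝ) = 0 := by
    ext; simp [Matrix.vecMulVec_apply]
  refine ⟨V * Vᵀ + β • Matrix.vecMulVec w w, ?_, ?_, ?_, ?_, ?_⟩
  · rw [Matrix.transpose_add, Matrix.transpose_mul, Matrix.transpose_transpose,
      Matrix.transpose_smul, Matrix.transpose_vecMulVec]
  · have e1 : V * Vᵀ * (V * Vᵀ) = V * Vᵀ := by
      rw [Matrix.mul_assoc, ← Matrix.mul_assoc Vᵀ, hV, Matrix.one_mul]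
    have e2 : V * Vᵀ * Matrix.vecMulVec w w = 0 := by
      rw [Matrix.mul_assoc, Matrix.mul_vecMulVec, hVw, Matrix.zero_vecMulVec, Matrix.mul_zero]
    have e3 : Matrix.vecMulVec w w * (V * Vᵀ) = 0 := by
      rw [← Matrix.mul_assoc, Matrix.vecMulVec_mul, hwV, hz, Matrix.zero_mul]
    have e4 : (β * β) • (Matrix.vecMulVec w w * Matrix.vecMulVec w w) = β • Matrix.vecMulVec w w := by
      have : Matrix.vecMulVec w w * Matrix.vecMulVec w w = (w ⬝ᵥ w) • Matrix.vecMulVec w w := by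
        rw [Matrix.vecMulVec_mul_vecMulVec]
        ext
        simp [Matrix.vecMulVec_apply]
        ring
      rw [this, smul_smul, mul_assoc, ← smul_smul, ← Matrix.smul_vecMulVec (β * _), hβw]
    rw [Matrix.add_mul, Matrix.mul_add, Matrix.mul_add, e1, Matrix.mul_smul, e2, Matrix.smul_mul, e3,
      Matrix.smul_mul, Matrix.mul_smul, smul_smul, e4]
    simp
  · rw [Matrix.trace_add, Matrix.trace_mul_comm, hV, Matrix.trace_one, Fintype.card_fin,
      Matrix.trace_smul, Matrix.trace_vecMulVec, smul_eq_mul]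
    have : β * (w ⬝ᵥ w) ≤ 1 := inv_mul_le_one
    linarith
  · rw [Matrix.add_mulVec, Matrix.smul_mulVec, Matrix.vecMulVec_mulVec, hwx]
    have : β • (MulOpposite.op (w ⬝ᵥ w) • w) = w := by
      conv_rhs => rw [← hβw]
      rw [op_smul_eq_smul, smul_smul]
    rw [this, ← Matrix.mulVec_mulVec, hw]
    abel
  · rw [Matrix.add_mul, Matrix.mul_assoc, hV, Matrix.mul_one, Matrix.smul_mul, Matrix.vecMulVec_mul,
      hwV, hz, smul_zero, add_zero]

theorem exists_eq_transpose_mul_self {n : ℕ} {E : Matrix (Fin n) (Fin n) ℝ} (hE : E.PosSemidef) :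
    ∃ B : Matrix (Fin n) (Fin n) ℝ, E = Bᵀ * B := by
  obtain ⟨B, rfl⟩ := CStarAlgebra.nonneg_iff_eq_star_mul_self.1 hE.nonneg
  exact ⟨B, by rw [Matrix.star_eq_conjTranspose, Matrix.conjTranspose_eq_transpose_of_trivial]⟩

theorem posSemidef_transpose_mul_self {a b : ℕ} (B : Matrix (Fin a) (Fin b) ℝ) :
    (Bᵀ * B).PosSemidef := by
  rw [← Matrix.conjTranspose_eq_transpose_of_trivial]
  exact Matrix.posSemidef_conjTranspose_mul_self B

theorem norm_le_of_quadForm_le {n : ℕ} {E : Matrix (Fin n) (Fin n) ℝ} (hE : E.PosSemidef) {c : ℝ}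
    (hc : 0 ≤ c) (h : ∀ x, x ⬝ᵥ (E *ᵥ x) ≤ c * (x ⬝ᵥ x)) : ‖E‖ ≤ c := by
  obtain ⟨B, rfl⟩ := exists_eq_transpose_mul_self hE
  rw [← Matrix.conjTranspose_eq_transpose_of_trivial, Matrix.l2_opNorm_conjTranspose_mul_self]
  have hB : ‖B‖ ≤ √c := by
    rw [Matrix.l2_opNorm_def]
    refine ContinuousLinearMap.opNorm_le_bound _ (Real.sqrt_nonneg _) fun x => ?_
    have hx := h x.ofLp
    rw [← Matrix.mulVec_mulVec, Matrix.dotProduct_mulVec, Matrix.vecMul_transpose] at hx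
    rw [EuclideanSpace.norm_eq, EuclideanSpace.norm_eq, ← Real.sqrt_mul hc]
    refine Real.sqrt_le_sqrt ?_
    simpa [dotProduct, sq] using hx
  calc ‖B‖ * ‖B‖ ≤ √c * √c := mul_self_le_mul_self (norm_nonneg _) hB
    _ = c := Real.mul_self_sqrt hc

/-! ### Structure and deterministic error of the Nyström output -/

/-- The part of a matrix `V diag(d) Vᵀ` carried by the columns with index less than `k`. -/
def truncated {n N : ℕ} (V : Matrix (Fin n) (Fin N) ℝ) (σ : Fin N → ℝ) (k : ℕ) :
    Matrix (Fin n) (Fin n) ℝ :=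
  V * Matrix.diagonal (fun i : Fin N => if (i : ℕ) < k then σ i ^ 2 else 0) * Vᵀ

theorem posSemidef_mul_diagonal_mul_transpose {n N : ℕ} (V : Matrix (Fin n) (Fin N) ℝ)
    {d : Fin N → ℝ} (hd : ∀ i, 0 ≤ d i) : (V * Matrix.diagonal d * Vᵀ).PosSemidef := by
  have h := (Matrix.PosSemidef.diagonal (d := d) hd).mul_mul_conjTranspose_same V
  rwa [Matrix.conjTranspose_eq_transpose_of_trivial] at h

theorem truncated_mono {n N : ℕ} (V : Matrix (Fin n) (Fin N) ℝ) (σ : Fin N → ℝ) {k l : ℕ}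
    (h : k ≤ l) : (truncated V σ l - truncated V σ k).PosSemidef := by
  have : truncated V σ l - truncated V σ k = V * Matrix.diagonal (fun i : Fin N =>
      (if (i : ℕ) < l then σ i ^ 2 else 0) - (if (i : ℕ) < k then σ i ^ 2 else 0)) * Vᵀ := by
    rw [truncated, truncated, ← Matrix.sub_mul, ← Matrix.mul_sub, Matrix.diagonal_sub]
  rw [this]
  refine posSemidef_mul_diagonal_mul_transpose V fun i => ?_
  split_ifs with h1 h2 h2
  · simp
  · simpa using sq_nonneg _
  · omega
  · simp

/-- A Nyström output is a truncation of `Aᵀ Q A`, where `Q = Tᵀ T` is the orthogonal projection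
onto the range of `A Ω`. -/
theorem IsNystromOutput.exists_proj {m n ℓ k : ℕ} {A : Matrix (Fin m) (Fin n) ℝ}
    {Om : Matrix (Fin n) (Fin ℓ) ℝ} {Hhat : Matrix (Fin n) (Fin n) ℝ}
    (h : IsNystromOutput (Aᵀ * A) Om k Hhat) :
    ∃ (Q : Matrix (Fin m) (Fin m) ℝ) (σ : Fin (min ℓ n) → ℝ)
      (V : Matrix (Fin n) (Fin (min ℓ n)) ℝ), Qᵀ = Q ∧ Q * Q = Q ∧ Q * (A * Om) = A * Om ∧
      Vᵀ * V = 1 ∧ Antitone σ ∧ (∀ i, 0 ≤ σ i) ∧ Aᵀ * Q * A = truncated V σ (min ℓ n) ∧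
      Hhat = truncated V σ k := by
  obtain ⟨Y, C, L, X, U, σ, V, rfl, rfl, -, -, hL, hX, hU, hV, hσ, hσ0, hW, rfl⟩ := h
  have hsym : (Omᵀ * (Aᵀ * A * Om))ᵀ = Omᵀ * (Aᵀ * A * Om) := by
    simp [Matrix.transpose_mul, Matrix.mul_assoc]
  have hL' : L * Lᵀ = Omᵀ * (Aᵀ * A * Om) := by
    rw [hL, hsym, ← two_smul ℝ, smul_smul]; norm_num
  have e1 : Lᵀ * Xᵀ = X * L := by rw [← Matrix.transpose_mul, hX.symm_right]
  have e2 : Xᵀ * Lᵀ = L * X := by rw [← Matrix.transpose_mul, hX.symm_left]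
  -- `T` is a partial isometry, since `TTᵀ = XL` is a projection, and `TA` is the matrix whose thin
  -- SVD the algorithm takes.
  set T : Matrix (Fin ℓ) (Fin m) ℝ := X * (A * Om)ᵀ with hT
  have hTt : Tᵀ = A * Om * Xᵀ := by
    rw [hT, Matrix.transpose_mul, Matrix.transpose_transpose]
  have hG : (A * Om)ᵀ * (A * Om) = L * Lᵀ := by
    rw [hL', Matrix.transpose_mul]; simp only [Matrix.mul_assoc]
  have hTTt : T * Tᵀ = X * L := by
    calc T * Tᵀ = X * ((A * Om)ᵀ * (A * Om)) * Xᵀ := by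
          rw [hTt, hT]; simp only [Matrix.mul_assoc]
      _ = X * L * (Lᵀ * Xᵀ) := by rw [hG]; simp only [Matrix.mul_assoc]
      _ = X * L * X * L := by rw [e1]; simp only [Matrix.mul_assoc]
      _ = X * L := by rw [hX.mul_mul']
  have hTTT : T * Tᵀ * T = T := by
    rw [hTTt, hT, ← Matrix.mul_assoc, hX.mul_mul']
  -- `AΩ(LX - 1)` has zero Gram matrix, so the projection `LX` acts trivially on `AΩ` even when the
  -- Cholesky factor is singular.
  have hrange : A * Om * (L * X) = A * Om := by
    have h0 : (A * Om * (L * X - 1))ᵀ * (A * Om * (L * X - 1)) = 0 := by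
      have h1 : L * Lᵀ * (L * X - 1) = 0 := by
        have : Lᵀ * (L * X) = Lᵀ := by
          rw [← e2, ← Matrix.mul_assoc, ← Matrix.transpose_mul, ← Matrix.transpose_mul,
            ← Matrix.mul_assoc, hX.mul_mul]
        rw [Matrix.mul_sub, Matrix.mul_one, Matrix.mul_assoc, this, sub_self]
      rw [Matrix.transpose_mul, Matrix.mul_assoc, ← Matrix.mul_assoc (A * Om)ᵀ, hG, h1,
        Matrix.mul_zero]
    rw [← Matrix.conjTranspose_eq_transpose_of_trivial,
      Matrix.conjTranspose_mul_self_eq_zero, Matrix.mul_sub, Matrix.mul_one, sub_eq_zero] at h0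
    exact h0
  have hTA : T * A = U * Matrix.diagonal σ * Vᵀ := by
    rw [← hW, hT]
    simp only [Matrix.transpose_mul, Matrix.transpose_transpose, Matrix.mul_assoc]
  refine ⟨Tᵀ * T, σ, V, ?_, ?_, ?_, hV, hσ, hσ0, ?_, rfl⟩
  · rw [Matrix.transpose_mul, Matrix.transpose_transpose]
  · rw [Matrix.mul_assoc, ← Matrix.mul_assoc T, hTTT]
  · calc Tᵀ * T * (A * Om) = A * Om * Xᵀ * X * ((A * Om)ᵀ * (A * Om)) := by
          rw [hTt, hT]; simp only [Matrix.mul_assoc]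
      _ = A * Om * (Xᵀ * (X * L * Lᵀ)) := by rw [hG]; simp only [Matrix.mul_assoc]
      _ = A * Om * (Xᵀ * ((X * L)ᵀ * Lᵀ)) := by rw [hX.symm_right]
      _ = A * Om * ((L * X * (L * X))ᵀ) := by
          simp only [Matrix.transpose_mul, Matrix.mul_assoc]
      _ = A * Om := by
          rw [← Matrix.mul_assoc, hX.mul_mul, hX.symm_left, hrange]
  · have hd : Matrix.diagonal (fun i : Fin (min ℓ n) => if (i : ℕ) < min ℓ n then σ i ^ 2 else 0)
        = Matrix.diagonal σ * Matrix.diagonal σ := by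
      rw [Matrix.diagonal_mul_diagonal]
      congr 1
      funext i
      simp [i.2, sq]
    calc Aᵀ * (Tᵀ * T) * A = (T * A)ᵀ * (T * A) := by
          simp only [Matrix.transpose_mul, Matrix.mul_assoc]
      _ = V * Matrix.diagonal σ * (Uᵀ * U) * (Matrix.diagonal σ * Vᵀ) := by
          rw [hTA]
          simp only [Matrix.transpose_mul, Matrix.transpose_transpose, Matrix.diagonal_transpose,
            Matrix.mul_assoc]
      _ = truncated V σ (min ℓ n) := by
          rw [hU, Matrix.mul_one, truncated, hd]
          simp only [Matrix.mul_assoc]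

/-- The Frobenius bound for the projection of `A` onto the range of `A Ω`. -/
theorem trace_residual_le {m n ℓ r : ℕ} {A : Matrix (Fin m) (Fin n) ℝ}
    {Om : Matrix (Fin n) (Fin ℓ) ℝ} {Q : Matrix (Fin m) (Fin m) ℝ} (hQs : Qᵀ = Q) (hQi : Q * Q = Q)
    (hQ : Q * (A * Om) = A * Om) (W : Matrix (Fin n) (Fin r) ℝ) (X : Matrix (Fin ℓ) (Fin r) ℝ) :
    (Wᵀ * (Aᵀ * A - Aᵀ * Q * A) * W).trace
      ≤ ((W - Om * X)ᵀ * (Aᵀ * A) * (W - Om * X)).trace := by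
  set D := A * (W - Om * X) with hD
  -- `Q` fixes `AΩ`, so subtracting `ΩX` from `W` changes nothing after applying `1 - Q`, whatever
  -- `X` is.
  have h1 : (1 - Q) * A * W = (1 - Q) * D := by
    have : (1 - Q) * (A * (Om * X)) = 0 := by
      rw [← Matrix.mul_assoc A, ← Matrix.mul_assoc, Matrix.sub_mul, Matrix.one_mul, hQ, sub_self,
        Matrix.zero_mul]
    rw [hD, Matrix.mul_sub, Matrix.mul_sub, this, sub_zero, Matrix.mul_assoc]
  have h2 : Wᵀ * (Aᵀ * A - Aᵀ * Q * A) * W = ((1 - Q) * D)ᵀ * ((1 - Q) * D) := by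
    rw [← h1]
    calc Wᵀ * (Aᵀ * A - Aᵀ * Q * A) * W = Wᵀ * Aᵀ * (1 - Q) * A * W := by
          simp only [Matrix.mul_sub, Matrix.sub_mul, Matrix.mul_assoc, Matrix.one_mul]
      _ = Wᵀ * Aᵀ * ((1 - Q)ᵀ * (1 - Q)) * A * W := by rw [proj_compl hQs hQi]
      _ = _ := by simp only [Matrix.transpose_mul, Matrix.mul_assoc]
  have h3 : ((1 - Q) * D)ᵀ * ((1 - Q) * D) = Dᵀ * D - (Q * D)ᵀ * (Q * D) := by
    have e1 : ((1 - Q) * D)ᵀ * ((1 - Q) * D) = Dᵀ * ((1 - Q)ᵀ * (1 - Q)) * D := by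
      simp only [Matrix.transpose_mul, Matrix.mul_assoc]
    have e2 : (Q * D)ᵀ * (Q * D) = Dᵀ * (Qᵀ * Q) * D := by
      simp only [Matrix.transpose_mul, Matrix.mul_assoc]
    rw [e1, e2, proj_compl hQs hQi, hQs, hQi, Matrix.mul_sub, Matrix.mul_one, Matrix.sub_mul]
  have h4 : (W - Om * X)ᵀ * (Aᵀ * A) * (W - Om * X) = Dᵀ * D := by
    rw [hD, Matrix.transpose_mul]; simp only [Matrix.mul_assoc]
  rw [h2, h3, h4, Matrix.trace_sub]
  linarith [trace_transpose_mul_self_nonneg (Q * D)]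

theorem trace_truncated {n N : ℕ} {V : Matrix (Fin n) (Fin N) ℝ} (hV : Vᵀ * V = 1)
    (σ : Fin N → ℝ) (k : ℕ) :
    (truncated V σ k).trace = ∑ i with (i : Fin N).val < k, σ i ^ 2 := by
  rw [truncated, Matrix.trace_mul_comm, ← Matrix.mul_assoc, hV, Matrix.one_mul,
    Matrix.trace_diagonal, Finset.sum_filter]

/-- The deterministic error bound for the truncated Nyström approximation: `V₀` diagonalizes `Aᵀ A`,
and `X` is a right inverse of the first `r` rows of `V₀ᵀ Ω`. -/
theorem IsNystromOutput.error_bound {m n ℓ k r : ℕ} {A : Matrix (Fin m) (Fin n) ℝ}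
    {Om : Matrix (Fin n) (Fin ℓ) ℝ} {Hhat : Matrix (Fin n) (Fin n) ℝ}
    (h : IsNystromOutput (Aᵀ * A) Om k Hhat) (hrk : r ≤ k) (hrn : r ≤ n) (hrl : r ≤ ℓ)
    {V₀ : Matrix (Fin n) (Fin n) ℝ} (hV₀ : V₀ᵀ * V₀ = 1) {d : Fin n → ℝ}
    (hH : Aᵀ * A = V₀ * Matrix.diagonal d * V₀ᵀ) {t : ℝ} (ht : 0 ≤ t) (hd0 : ∀ j, 0 ≤ d j)
    (hlt : ∀ j : Fin n, j.val < r → t ≤ d j) (hge : ∀ j : Fin n, r ≤ j.val → d j ≤ t)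
    (X : Matrix (Fin ℓ) (Fin r) ℝ)
    (hX : ∀ i i' : Fin r, (V₀ᵀ * Om * X) (Fin.castLE hrn i) i' = if i = i' then 1 else 0) :
    Hhat.PosSemidef ∧ (Aᵀ * A - Hhat).PosSemidef ∧
      ‖Aᵀ * A - Hhat‖ ≤ t + ∑ j with r ≤ (j : Fin n).val, d j * ∑ i, (V₀ᵀ * Om * X) j i ^ 2 := by
  obtain ⟨Q, σ, V, hQs, hQi, hQ, hV, hσ, hσ0, hAQA, rfl⟩ := h.exists_proj
  have hN : r ≤ min ℓ n := le_min hrl hrn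
  set F := ∑ j with r ≤ (j : Fin n).val, d j * ∑ i, (V₀ᵀ * Om * X) j i ^ 2 with hF
  have hF0 : 0 ≤ F := Finset.sum_nonneg fun j _ =>
    mul_nonneg (hd0 j) (Finset.sum_nonneg fun _ _ => sq_nonneg _)
  have hfull : ∀ k, (truncated V σ (min ℓ n) - truncated V σ k).PosSemidef := fun k => by
    have : truncated V σ (min ℓ n) = truncated V σ (max k (min ℓ n)) := by
      rw [truncated, truncated]
      congr 3
      funext i
      rw [if_pos i.2, if_pos (lt_max_of_lt_right i.2)]
    rw [this]
    exact truncated_mono V σ (le_max_left _ _)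
  have hres : (Aᵀ * A - truncated V σ (min ℓ n)).PosSemidef := by
    have : Aᵀ * A - truncated V σ (min ℓ n) = ((1 - Q) * A)ᵀ * ((1 - Q) * A) := by
      rw [← hAQA, Matrix.transpose_mul, Matrix.mul_assoc Aᵀ (1 - Q)ᵀ, ← Matrix.mul_assoc _ _ A,
        proj_compl hQs hQi, Matrix.sub_mul, Matrix.mul_sub, Matrix.one_mul, Matrix.mul_assoc]
    rw [this]
    exact posSemidef_transpose_mul_self _
  have hE : ∀ k, (Aᵀ * A - truncated V σ k).PosSemidef := fun k => by
    have := hres.add (hfull k)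
    rwa [sub_add_sub_cancel] at this
  refine ⟨posSemidef_mul_diagonal_mul_transpose V fun i => by split_ifs <;> positivity, hE k, ?_⟩
  -- the retained part of the trace
  let W : Matrix (Fin n) (Fin r) ℝ := Matrix.of fun a i => V₀ a (Fin.castLE hrn i)
  have hW : Wᵀ * W = 1 := by
    ext i j
    have h1 := congrFun (congrFun hV₀ (Fin.castLE hrn i)) (Fin.castLE hrn j)
    rw [Matrix.mul_apply] at h1
    rw [Matrix.mul_apply]
    refine h1.trans ?_
    simp [Matrix.one_apply, Fin.ext_iff]
  have hV₀W : ∀ j i, (V₀ᵀ * W) j i = if j = Fin.castLE hrn i then 1 else 0 := fun j i => by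
    have h1 := congrFun (congrFun hV₀ j) (Fin.castLE hrn i)
    rw [Matrix.mul_apply] at h1
    rw [Matrix.mul_apply]
    exact h1.trans (Matrix.one_apply ..)
  have hquad : ∀ M : Matrix (Fin n) (Fin r) ℝ,
      (Mᵀ * (Aᵀ * A) * M).trace = ∑ j, d j * ∑ i, (V₀ᵀ * M) j i ^ 2 := fun M => by
    have : Mᵀ * (Aᵀ * A) * M = (V₀ᵀ * M)ᵀ * (Matrix.diagonal d * (V₀ᵀ * M)) := by
      rw [hH, Matrix.transpose_mul, Matrix.transpose_transpose]; simp only [Matrix.mul_assoc]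
    rw [this]
    simp only [Matrix.trace, Matrix.diag_apply, Matrix.mul_apply (M := (V₀ᵀ * M)ᵀ),
      Matrix.transpose_apply (V₀ᵀ * M), Matrix.diagonal_mul]
    rw [Finset.sum_comm]
    refine Finset.sum_congr rfl fun j _ => ?_
    rw [Finset.mul_sum]
    exact Finset.sum_congr rfl fun i _ => by ring
  have hWH : (Wᵀ * (Aᵀ * A) * W).trace = ∑ j with (j : Fin n).val < r, d j := by
    rw [hquad, Finset.sum_filter]
    refine Finset.sum_congr rfl fun j _ => ?_
    split_ifs with hj
    · rw [Finset.sum_eq_single ⟨j, hj⟩]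
      · have hj' : j = Fin.castLE hrn ⟨j, hj⟩ := rfl
        rw [hV₀W, if_pos hj']; ring
      · intro i _ hi
        rw [hV₀W, if_neg]
        · ring
        · rintro rfl; exact hi rfl
      · simp
    · rw [Finset.sum_eq_zero, mul_zero]
      intro i _
      rw [hV₀W, if_neg]
      · ring
      · rintro rfl; exact hj i.2
  have hDF : ((W - Om * X)ᵀ * (Aᵀ * A) * (W - Om * X)).trace = F := by
    rw [hquad, hF, Finset.sum_filter]
    refine Finset.sum_congr rfl fun j _ => ?_
    rw [Matrix.mul_sub, ← Matrix.mul_assoc]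
    split_ifs with hj
    · congr 1
      refine Finset.sum_congr rfl fun i _ => ?_
      rw [Matrix.sub_apply, hV₀W, if_neg]
      · ring
      · rintro rfl; exact absurd i.2 (not_lt.2 hj)
    · rw [Finset.sum_eq_zero, mul_zero]
      intro i _
      have := hX ⟨j, not_le.1 hj⟩ i
      rw [Matrix.sub_apply, hV₀W]
      change (V₀ᵀ * Om * X) j i = _ at this
      rw [this]
      have : (j = Fin.castLE hrn i) ↔ ((⟨j, not_le.1 hj⟩ : Fin r) = i) := by
        simp [Fin.ext_iff]
      simp [this]
  have hP1s : (W * Wᵀ)ᵀ = W * Wᵀ := by rw [Matrix.transpose_mul, Matrix.transpose_transpose]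
  have hP1i : W * Wᵀ * (W * Wᵀ) = W * Wᵀ := by
    rw [Matrix.mul_assoc, ← Matrix.mul_assoc Wᵀ, hW, Matrix.one_mul]
  have hP1t : (W * Wᵀ).trace ≤ r := by
    rw [Matrix.trace_mul_comm, hW, Matrix.trace_one, Fintype.card_fin]
  -- On `W` the loss is at most `F`, and by Ky Fan the trace of `AᵀQA` against `WWᵀ` is at most the
  -- sum of its `r` largest eigenvalues.
  have hkeep : ∑ j with (j : Fin n).val < r, d j - F ≤ (truncated V σ r).trace := by
    have h1 := trace_residual_le hQs hQi hQ W X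
    rw [hDF, Matrix.mul_sub, Matrix.sub_mul, Matrix.trace_sub, hWH, hAQA] at h1
    have hsq : ∀ {i j : Fin (min ℓ n)}, i ≤ j → σ j ^ 2 ≤ σ i ^ 2 := fun {i j} hij =>
      pow_le_pow_left₀ (hσ0 j) (hσ hij) 2
    have h2 : (W * Wᵀ * truncated V σ (min ℓ n)).trace ≤ (truncated V σ r).trace := by
      rw [trace_truncated hV]
      have hdd : truncated V σ (min ℓ n) = V * Matrix.diagonal (fun i => σ i ^ 2) * Vᵀ := by
        rw [truncated]; congr 3; funext i; rw [if_pos i.2]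
      rw [hdd]
      -- Here `q = m = r`, so the threshold term vanishes. The threshold is the first discarded
      -- squared singular value, or 0 when none is discarded.
      by_cases hr : r < min ℓ n
      · have := trace_proj_mul_le hN hP1s hP1i hP1t hV (d := fun i => σ i ^ 2)
          (t := σ ⟨r, hr⟩ ^ 2) (sq_nonneg _) (fun j hj => hsq (Fin.le_def.2 hj.le))
          (fun j hj => hsq (Fin.le_def.2 hj))
        simpa using this
      · have := trace_proj_mul_le hN hP1s hP1i hP1t hV (d := fun i => σ i ^ 2)
          (t := 0) le_rfl (fun j hj => sq_nonneg _) (fun j hj => absurd j.2 (by omega))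
        simpa using this
    have h3 : (Wᵀ * truncated V σ (min ℓ n) * W).trace
        = (W * Wᵀ * truncated V σ (min ℓ n)).trace := by
      rw [Matrix.trace_mul_comm, ← Matrix.mul_assoc]
    linarith
  -- the error of the rank-`r` truncation
  let Vr : Matrix (Fin n) (Fin r) ℝ := Matrix.of fun a i => V a (Fin.castLE hN i)
  have hVr : Vrᵀ * Vr = 1 := by
    ext i j
    have h1 := congrFun (congrFun hV (Fin.castLE hN i)) (Fin.castLE hN j)
    rw [Matrix.mul_apply] at h1
    rw [Matrix.mul_apply]
    refine h1.trans ?_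
    simp [Matrix.one_apply, Fin.ext_iff]
  have hquadE : ∀ x, x ⬝ᵥ ((Aᵀ * A - truncated V σ r) *ᵥ x) ≤ (t + F) * (x ⬝ᵥ x) := fun x => by
    obtain ⟨P, hPs, hPi, hPt, hPx, hPV⟩ := GNSketch.exists_proj hVr x
    obtain ⟨B, hB⟩ := exists_eq_transpose_mul_self (hE r)
    have h1 := mulVec_self_le_trace_proj hPs hPi B hPx
    rw [← hB] at h1
    have h2 : x ⬝ᵥ ((Aᵀ * A - truncated V σ r) *ᵥ x) = (B *ᵥ x) ⬝ᵥ (B *ᵥ x) := by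
      rw [hB, ← Matrix.mulVec_mulVec, Matrix.dotProduct_mulVec, Matrix.vecMul_transpose]
    have h3 : P * truncated V σ r = truncated V σ r := by
      have h4 : P * (V * Matrix.diagonal
          (fun i : Fin (min ℓ n) => if (i : ℕ) < r then σ i ^ 2 else 0)) = V * Matrix.diagonal
          (fun i : Fin (min ℓ n) => if (i : ℕ) < r then σ i ^ 2 else 0) := by
        ext a i
        rw [← Matrix.mul_assoc, Matrix.mul_diagonal, Matrix.mul_diagonal]
        split_ifs with hi
        · congr 1
          have := congrFun (congrFun hPV a) ⟨i, hi⟩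
          rw [Matrix.mul_apply] at this
          rw [Matrix.mul_apply]
          exact this
        · simp
      rw [truncated, ← Matrix.mul_assoc, h4]
    -- Trace at most `r + 1` against cut-off `r`: the threshold term contributes exactly one `t`.
    have h5 := trace_proj_mul_le hrn hPs hPi hPt hV₀ ht hlt hge
    rw [← hH] at h5
    rw [Matrix.mul_sub, h3, Matrix.trace_sub] at h1
    rw [h2]
    refine h1.trans ?_
    rw [mul_comm]
    refine mul_le_mul_of_nonneg_right ?_ (Finset.sum_nonneg fun _ _ => mul_self_nonneg _)
    linarith
  refine norm_le_of_quadForm_le (hE k) (add_nonneg ht hF0) fun x => le_trans ?_ (hquadE x)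
  -- Keeping `k ≥ r` terms only decreases the error in the Loewner order.
  have h6 := (truncated_mono V σ hrk).dotProduct_mulVec_nonneg x
  simp only [star_trivial, Matrix.sub_mulVec, dotProduct_sub] at h6 ⊢
  linarith

/-! ### From the spectral error to the step and the condition number -/

theorem posDef_one_add {n : ℕ} {M : Matrix (Fin n) (Fin n) ℝ} (hM : M.PosSemidef) :
    (1 + M).PosDef := Matrix.PosDef.one.add_posSemidef hM

/-- With `x = y + My` the quadratic form of the inverse is `|y|² + yᵀMy`, while `|x|² = |y|² + 2yᵀMy
+ |My|²`. -/
theorem norm_inv_one_add_le {n : ℕ} {M : Matrix (Fin n) (Fin n) ℝ} (hM : M.PosSemidef) :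
    ‖(1 + M)⁻¹‖ ≤ 1 := by
  have hpd := posDef_one_add hM
  refine norm_le_of_quadForm_le hpd.inv.posSemidef zero_le_one fun x => ?_
  set y := (1 + M)⁻¹ *ᵥ x with hy
  have hx : x = y + M *ᵥ y := by
    have : (1 + M) *ᵥ y = x := by
      rw [hy, Matrix.mulVec_mulVec, Matrix.mul_nonsing_inv _ hpd.det_pos.ne'.isUnit,
        Matrix.one_mulVec]
    rw [← this, Matrix.add_mulVec, Matrix.one_mulVec]
  have h1 : 0 ≤ y ⬝ᵥ (M *ᵥ y) := hM.dotProduct_mulVec_nonneg y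
  have h2 : 0 ≤ (M *ᵥ y) ⬝ᵥ (M *ᵥ y) := Finset.sum_nonneg fun _ _ => mul_self_nonneg _
  rw [hx]
  simp only [add_dotProduct, dotProduct_add, dotProduct_comm (M *ᵥ y) y, one_mul]
  linarith

/-- Only an inequality, because the norm is 0 in dimension 0. -/
theorem norm_one_le_one {n : ℕ} : ‖(1 : Matrix (Fin n) (Fin n) ℝ)‖ ≤ 1 := by
  simpa using norm_inv_one_add_le (Matrix.PosSemidef.zero (n := Fin n) (R := ℝ))

theorem transpose_sqrt {n : ℕ} (M : Matrix (Fin n) (Fin n) ℝ) :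
    (CFC.sqrt M)ᵀ = CFC.sqrt M := by
  rw [← Matrix.conjTranspose_eq_transpose_of_trivial]
  exact (Matrix.nonneg_iff_posSemidef.1 (CFC.sqrt_nonneg M)).1

theorem isUnit_det_sqrt {n : ℕ} {M : Matrix (Fin n) (Fin n) ℝ} (hM : M.PosDef) :
    IsUnit (CFC.sqrt M).det := by
  have h : (CFC.sqrt M * CFC.sqrt M).det = M.det := by
    rw [CFC.sqrt_mul_sqrt_self M hM.posSemidef.nonneg]
  rw [Matrix.det_mul] at h
  refine isUnit_iff_ne_zero.2 fun h0 => hM.det_pos.ne' ?_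
  rw [← h, h0, zero_mul]

theorem sqrt_inv_mul_self {n : ℕ} {M : Matrix (Fin n) (Fin n) ℝ} (hM : M.PosDef) :
    (CFC.sqrt M)⁻¹ * (CFC.sqrt M)⁻¹ = M⁻¹ := by
  rw [← Matrix.mul_inv_rev, CFC.sqrt_mul_sqrt_self M hM.posSemidef.nonneg]

theorem sqrt_inv_conj {n : ℕ} {M : Matrix (Fin n) (Fin n) ℝ} (hM : M.PosDef) :
    (CFC.sqrt M)⁻¹ * M * (CFC.sqrt M)⁻¹ = 1 := by
  have hu := isUnit_det_sqrt hM
  nth_rewrite 2 [← CFC.sqrt_mul_sqrt_self M hM.posSemidef.nonneg]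
  rw [← Matrix.mul_assoc, Matrix.nonsing_inv_mul _ hu, Matrix.one_mul, Matrix.mul_nonsing_inv _ hu]

theorem norm_mul_transpose_self {a b : ℕ} (B : Matrix (Fin a) (Fin b) ℝ) :
    ‖B * Bᵀ‖ = ‖Bᵀ * B‖ := by
  have h1 := Matrix.l2_opNorm_conjTranspose_mul_self B
  have h2 := Matrix.l2_opNorm_conjTranspose_mul_self Bᴴ
  rw [Matrix.conjTranspose_conjTranspose, Matrix.l2_opNorm_conjTranspose] at h2
  rw [Matrix.conjTranspose_eq_transpose_of_trivial] at h1 h2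
  rw [h1, h2]

/-- The condition number of the preconditioned operator, without square roots of `1 + Ĥ`. -/
theorem cond_precondOp_eq {n : ℕ} {H Hhat : Matrix (Fin n) (Fin n) ℝ} (hH : H.PosSemidef)
    (hHhat : Hhat.PosSemidef) :
    cond (precondOp H Hhat) = ‖CFC.sqrt (1 + H) * (1 + Hhat)⁻¹ * CFC.sqrt (1 + H)‖ *
      ‖(CFC.sqrt (1 + H))⁻¹ * (1 + Hhat) * (CFC.sqrt (1 + H))⁻¹‖ := by
  have hN := posDef_one_add hH
  have hM := posDef_one_add hHhat
  have hNs := CFC.sqrt_mul_sqrt_self (1 + H) hN.posSemidef.nonneg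
  have hMs := CFC.sqrt_mul_sqrt_self (1 + Hhat) hM.posSemidef.nonneg
  have hMi := sqrt_inv_mul_self hM
  have hNi := sqrt_inv_mul_self hN
  have hRt := transpose_sqrt (1 + H)
  have hSt := transpose_sqrt (1 + Hhat)
  have hu := isUnit_det_sqrt hM
  set R := CFC.sqrt (1 + H)
  set S := CFC.sqrt (1 + Hhat) with hS
  have hRit : (R⁻¹)ᵀ = R⁻¹ := by rw [Matrix.transpose_nonsing_inv, hRt]
  have hSit : (S⁻¹)ᵀ = S⁻¹ := by rw [Matrix.transpose_nonsing_inv, hSt]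
  rw [cond]
  congr 1
  -- Swapping the factors of `BᵀB` inside the norm joins the two square roots of `1 + Ĥ`. The
  -- resulting matrices depend rationally on the entries of `Ĥ`, which yields measurability.
  · have e1 : precondOp H Hhat = (R * S⁻¹)ᵀ * (R * S⁻¹) := by
      rw [precondOp, ← hS, ← hNs, Matrix.transpose_mul, hRt, hSit]
      simp only [Matrix.mul_assoc]
    rw [e1, ← norm_mul_transpose_self, ← hMi, Matrix.transpose_mul, hRt, hSit]
    simp only [Matrix.mul_assoc]
  · have e1 : (precondOp H Hhat)⁻¹ = (R⁻¹ * S)ᵀ * (R⁻¹ * S) := by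
      rw [precondOp, ← hS, Matrix.mul_inv_rev, Matrix.mul_inv_rev, ← hNi,
        Matrix.nonsing_inv_nonsing_inv _ hu, Matrix.transpose_mul, hRit, hSt]
      simp only [Matrix.mul_assoc]
    rw [e1, ← norm_mul_transpose_self, ← hMs, Matrix.transpose_mul, hRit, hSt]
    simp only [Matrix.mul_assoc]

/-- Conjugation by `S⁻¹`, with `S` the square root of `1 + Ĥ`, gives `1 + S⁻¹(H - Ĥ)S⁻¹`. Its
inverse has norm at most 1, and `‖S⁻¹‖² = ‖(1 + Ĥ)⁻¹‖ ≤ 1`. -/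
theorem cond_precondOp_le {n : ℕ} {H Hhat : Matrix (Fin n) (Fin n) ℝ}
    (hHhat : Hhat.PosSemidef) (hE : (H - Hhat).PosSemidef) :
    cond (precondOp H Hhat) ≤ 1 + ‖H - Hhat‖ := by
  have hM := posDef_one_add hHhat
  have hc := sqrt_inv_conj hM
  have hMi := sqrt_inv_mul_self hM
  have hSt := transpose_sqrt (1 + Hhat)
  rw [cond, precondOp]
  set S := CFC.sqrt (1 + Hhat) with hS
  have hSit : (S⁻¹)ᵀ = S⁻¹ := by rw [Matrix.transpose_nonsing_inv, hSt]
  have h1 : S⁻¹ * (1 + H) * S⁻¹ = 1 + S⁻¹ * (H - Hhat) * S⁻¹ := by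
    have : 1 + H = (1 + Hhat) + (H - Hhat) := by abel
    rw [this, Matrix.mul_add, Matrix.add_mul, hc]
  have hpsd : (S⁻¹ * (H - Hhat) * S⁻¹).PosSemidef := by
    have := hE.mul_mul_conjTranspose_same S⁻¹
    rwa [Matrix.conjTranspose_eq_transpose_of_trivial, hSit] at this
  have hSn : ‖S⁻¹‖ * ‖S⁻¹‖ ≤ 1 := by
    rw [← Matrix.l2_opNorm_conjTranspose_mul_self, Matrix.conjTranspose_eq_transpose_of_trivial,
      hSit, hMi]
    exact norm_inv_one_add_le hHhat
  rw [h1]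
  have h2 : ‖1 + S⁻¹ * (H - Hhat) * S⁻¹‖ ≤ 1 + ‖H - Hhat‖ := by
    refine (norm_add_le _ _).trans (add_le_add norm_one_le_one ?_)
    calc ‖S⁻¹ * (H - Hhat) * S⁻¹‖ ≤ ‖S⁻¹ * (H - Hhat)‖ * ‖S⁻¹‖ := Matrix.l2_opNorm_mul _ _
      _ ≤ ‖S⁻¹‖ * ‖H - Hhat‖ * ‖S⁻¹‖ := by gcongr; exact Matrix.l2_opNorm_mul _ _
      _ = ‖S⁻¹‖ * ‖S⁻¹‖ * ‖H - Hhat‖ := by ring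
      _ ≤ 1 * ‖H - Hhat‖ := by gcongr
      _ = ‖H - Hhat‖ := one_mul _
  calc _ ≤ (1 + ‖H - Hhat‖) * 1 :=
        mul_le_mul h2 (norm_inv_one_add_le hpsd) (norm_nonneg _) (by positivity)
    _ = _ := mul_one _

theorem gnHessian_eq {m n : ℕ} {Γ : Matrix (Fin n) (Fin n) ℝ} (hΓ : Γ.PosDef)
    (G : Matrix (Fin m) (Fin n) ℝ) :
    gnHessian Γ G = sketchedHessian Γ (misfitHessian Γ G) := by
  have hu := isUnit_det_sqrt hΓ
  have hi := sqrt_inv_mul_self hΓ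
  rw [gnHessian, sketchedHessian, misfitHessian, forwardOp, Matrix.transpose_mul, transpose_sqrt,
    Matrix.mul_add, Matrix.add_mul, Matrix.mul_one, hi]
  congr 1
  calc Gᵀ * G = ((CFC.sqrt Γ)⁻¹ * CFC.sqrt Γ) * Gᵀ * G * (CFC.sqrt Γ * (CFC.sqrt Γ)⁻¹) := by
        rw [Matrix.nonsing_inv_mul _ hu, Matrix.mul_nonsing_inv _ hu, Matrix.one_mul,
          Matrix.mul_one]
    _ = _ := by simp only [Matrix.mul_assoc]

theorem sqrt_inv_mulVec_gnStep {n : ℕ} {Γ : Matrix (Fin n) (Fin n) ℝ} (hΓ : Γ.PosDef)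
    (M : Matrix (Fin n) (Fin n) ℝ) (g : Fin n → ℝ) :
    CFC.sqrt Γ⁻¹ *ᵥ gnStep (sketchedHessian Γ M) g = -((1 + M)⁻¹ *ᵥ (CFC.sqrt Γ *ᵥ g)) := by
  have hu := isUnit_det_sqrt hΓ
  rw [← hΓ.posSemidef.inv_sqrt, gnStep, sketchedHessian, Matrix.mul_inv_rev, Matrix.mul_inv_rev,
    Matrix.nonsing_inv_nonsing_inv _ hu, Matrix.mulVec_neg, Matrix.mulVec_mulVec,
    ← Matrix.mul_assoc, Matrix.nonsing_inv_mul _ hu, Matrix.one_mul, Matrix.mulVec_mulVec]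

/-- In the variable `Γ^{-1/2}x` the steps are `-(1 + H)⁻¹b` and `-(1 + Ĥ)⁻¹b`. By the resolvent
identity their difference is `(1 + Ĥ)⁻¹(H - Ĥ)` applied to `(1 + H)⁻¹b`, whose norm is the
denominator. -/
theorem relErr_le {n : ℕ} {Γ : Matrix (Fin n) (Fin n) ℝ} (hΓ : Γ.PosDef)
    {H Hhat : Matrix (Fin n) (Fin n) ℝ} (hH : H.PosSemidef) (hHhat : Hhat.PosSemidef)
    (g : Fin n → ℝ) :
    wnorm Γ⁻¹ (gnStep (sketchedHessian Γ H) g - gnStep (sketchedHessian Γ Hhat) g) /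
      wnorm Γ⁻¹ (gnStep (sketchedHessian Γ H) g) ≤ ‖H - Hhat‖ := by
  rw [wnorm, wnorm, Matrix.mulVec_sub, sqrt_inv_mulVec_gnStep hΓ, sqrt_inv_mulVec_gnStep hΓ]
  set b := CFC.sqrt Γ *ᵥ g
  set y := (1 + H)⁻¹ *ᵥ b with hy
  have huH : IsUnit (1 + H).det := (posDef_one_add hH).det_pos.ne'.isUnit
  have huM : IsUnit (1 + Hhat).det := (posDef_one_add hHhat).det_pos.ne'.isUnit
  have h1 : -y - -((1 + Hhat)⁻¹ *ᵥ b) = ((1 + Hhat)⁻¹ * (H - Hhat)) *ᵥ y := by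
    have e1 : (1 + Hhat)⁻¹ * (H - Hhat) * (1 + H)⁻¹ = (1 + Hhat)⁻¹ - (1 + H)⁻¹ := by
      have : H - Hhat = (1 + H) - (1 + Hhat) := by abel
      rw [this, Matrix.mul_sub, Matrix.sub_mul, Matrix.mul_assoc, Matrix.mul_nonsing_inv _ huH,
        Matrix.nonsing_inv_mul _ huM, Matrix.mul_one, Matrix.one_mul]
    have e2 : ((1 + Hhat)⁻¹ * (H - Hhat)) *ᵥ y
        = ((1 + Hhat)⁻¹ * (H - Hhat) * (1 + H)⁻¹) *ᵥ b := by
      rw [hy, Matrix.mulVec_mulVec]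
    rw [e2, e1, Matrix.sub_mulVec]
    abel
  rw [h1, WithLp.toLp_neg, norm_neg]
  refine div_le_of_le_mul₀ (norm_nonneg _) (norm_nonneg _) ?_
  refine (Matrix.l2_opNorm_mulVec _ (WithLp.toLp 2 y)).trans ?_
  refine mul_le_mul_of_nonneg_right ?_ (norm_nonneg _)
  calc ‖(1 + Hhat)⁻¹ * (H - Hhat)‖ ≤ ‖(1 + Hhat)⁻¹‖ * ‖H - Hhat‖ := Matrix.l2_opNorm_mul _ _
    _ ≤ 1 * ‖H - Hhat‖ := by gcongr; exact norm_inv_one_add_le hHhat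
    _ = ‖H - Hhat‖ := one_mul _

/-! ### Measurability -/

theorem measurable_matrix_mul {α : Type*} [MeasurableSpace α] {a b c : ℕ}
    {M : α → Matrix (Fin a) (Fin b) ℝ} {N : α → Matrix (Fin b) (Fin c) ℝ}
    (hM : ∀ i j, Measurable fun s => M s i j) (hN : ∀ i j, Measurable fun s => N s i j)
    (i : Fin a) (j : Fin c) : Measurable fun s => (M s * N s) i j := by
  simp only [Matrix.mul_apply]
  exact Finset.measurable_sum _ fun k _ => (hM i k).mul (hN k j)

theorem measurable_one_add {α : Type*} [MeasurableSpace α] {n : ℕ}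
    {M : α → Matrix (Fin n) (Fin n) ℝ} (hM : ∀ i j, Measurable fun s => M s i j) (i j : Fin n) :
    Measurable fun s => (1 + M s) i j := by
  simp only [Matrix.add_apply]
  exact (hM i j).const_add _

theorem measurable_norm_matrix {α : Type*} [MeasurableSpace α] {n : ℕ}
    {M : α → Matrix (Fin n) (Fin n) ℝ} (hM : ∀ i j, Measurable fun s => M s i j) :
    Measurable fun s => ‖M s‖ := by
  have h1 : Measurable fun s => fun i j => M s i j :=
    measurable_pi_iff.2 fun i => measurable_pi_iff.2 fun j => hM i j
  have h2 : Continuous fun M : Fin n → Fin n → ℝ => ‖(Matrix.of M : Matrix (Fin n) (Fin n) ℝ)‖ :=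
    continuous_norm (E := Matrix (Fin n) (Fin n) ℝ)
  exact h2.measurable.comp h1

theorem measurable_relErr {α : Type*} [MeasurableSpace α] {n : ℕ} (Γ : Matrix (Fin n) (Fin n) ℝ)
    {M : α → Matrix (Fin n) (Fin n) ℝ} (hM : ∀ i j, Measurable fun s => M s i j)
    (g x : Fin n → ℝ) (c : ℝ) :
    Measurable fun s => wnorm Γ⁻¹ (x - gnStep (sketchedHessian Γ (M s)) g) / c := by
  have h1 : ∀ i j, Measurable fun s => (sketchedHessian Γ (M s))⁻¹ i j :=
    measurable_inv_apply (measurable_matrix_mul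
      (measurable_matrix_mul (fun _ _ => measurable_const) (measurable_one_add hM))
      fun _ _ => measurable_const)
  have h2 : Measurable fun s => x - gnStep (sketchedHessian Γ (M s)) g := by
    refine measurable_pi_iff.2 fun i => ?_
    simp only [gnStep, Pi.sub_apply, Pi.neg_apply, Matrix.mulVec, dotProduct]
    exact measurable_const.sub (Finset.measurable_sum _ fun j _ => (h1 i j).mul_const _).neg
  have h3 : Continuous fun v : Fin n → ℝ => wnorm Γ⁻¹ v := by
    unfold wnorm
    exact ((PiLp.continuous_toLp 2 _).comp
      (Continuous.matrix_mulVec continuous_const continuous_id)).norm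
  exact (h3.measurable.comp h2).div_const c

theorem measurable_cond_formula {α : Type*} [MeasurableSpace α] {n : ℕ}
    (H : Matrix (Fin n) (Fin n) ℝ)
    {M : α → Matrix (Fin n) (Fin n) ℝ} (hM : ∀ i j, Measurable fun s => M s i j) :
    Measurable fun s => ‖CFC.sqrt (1 + H) * (1 + M s)⁻¹ * CFC.sqrt (1 + H)‖ *
      ‖(CFC.sqrt (1 + H))⁻¹ * (1 + M s) * (CFC.sqrt (1 + H))⁻¹‖ := by
  refine (measurable_norm_matrix ?_).mul (measurable_norm_matrix ?_)
  · exact measurable_matrix_mul (measurable_matrix_mul (fun _ _ => measurable_const)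
      (measurable_inv_apply (measurable_one_add hM))) fun _ _ => measurable_const
  · exact measurable_matrix_mul (measurable_matrix_mul (fun _ _ => measurable_const)
      (measurable_one_add hM)) fun _ _ => measurable_const

/-! ### Sorted eigenvalues and diagonalization -/

theorem eig_nonneg {n : ℕ} {H : Matrix (Fin n) (Fin n) ℝ} (hH : H.PosSemidef) (j : ℕ) :
    0 ≤ eig H j := by
  unfold eig
  split_ifs with h
  · have h1 := hH.eigenvalues_nonneg (Fintype.equivOfCardEq (Fintype.card_fin _)
      (⟨j - 1, by rw [Fintype.card_fin]; omega⟩ : Fin (Fintype.card (Fin n))))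
    rwa [Matrix.IsHermitian.eigenvalues, Equiv.symm_apply_apply] at h1
  · exact le_rfl

theorem eig_anti {n : ℕ} {H : Matrix (Fin n) (Fin n) ℝ} (hH : H.PosSemidef) {i j : ℕ}
    (hi : 1 ≤ i) (hij : i ≤ j) : eig H j ≤ eig H i := by
  by_cases hj : j ≤ n
  · rw [eig, eig, dif_pos ⟨hH.1, by omega, hj⟩, dif_pos ⟨hH.1, hi, by omega⟩]
    exact hH.1.eigenvalues₀_antitone (Fin.le_def.2 (by simp only; omega))
  · rw [eig, dif_neg fun h => hj h.2.2]
    exact eig_nonneg hH i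

theorem exists_diagonalization {n : ℕ} {H : Matrix (Fin n) (Fin n) ℝ} (hH : H.PosSemidef) :
    ∃ V : Matrix (Fin n) (Fin n) ℝ, Vᵀ * V = 1 ∧
      H = V * Matrix.diagonal (fun j : Fin n => eig H (j + 1)) * Vᵀ := by
  -- `e` sends a position in the sorted list to the index that `eigenvalues` assigns to it;
  -- reindexing the eigenvectors by `e` sorts them.
  let e : Fin n ≃ Fin n := (finCongr (Fintype.card_fin n).symm).trans
    (Fintype.equivOfCardEq (Fintype.card_fin _))
  let U : Matrix (Fin n) (Fin n) ℝ := hH.1.eigenvectorUnitary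
  have hU : Uᵀ * U = 1 := by
    have := Unitary.coe_star_mul_self hH.1.eigenvectorUnitary
    rwa [Matrix.star_eq_conjTranspose, Matrix.conjTranspose_eq_transpose_of_trivial] at this
  have hspec : H = U * Matrix.diagonal hH.1.eigenvalues * Uᵀ := by
    have := hH.1.spectral_theorem
    rw [Unitary.conjStarAlgAut_apply] at this
    conv_lhs => rw [this]
    rw [Matrix.star_eq_conjTranspose, Matrix.conjTranspose_eq_transpose_of_trivial]
    rfl
  have hd : (fun j : Fin n => eig H (j + 1)) = hH.1.eigenvalues ∘ e := by
    funext j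
    rw [eig, dif_pos ⟨hH.1, by omega, by omega⟩]
    simp only [Function.comp, Matrix.IsHermitian.eigenvalues, e, Equiv.trans_apply,
      Equiv.symm_apply_apply]
    rfl
  refine ⟨U.submatrix id e, ?_, ?_⟩
  · rw [Matrix.transpose_submatrix, ← Matrix.submatrix_mul _ _ _ _ _ Function.bijective_id, hU,
      Matrix.submatrix_one _ e.injective]
  · have h1 : Matrix.diagonal (hH.1.eigenvalues ∘ e)
        = (Matrix.diagonal hH.1.eigenvalues).submatrix e e :=
      (Matrix.submatrix_diagonal _ _ e.injective).symm
    rw [hd, h1, Matrix.transpose_submatrix, ← Matrix.submatrix_mul _ _ _ _ _ e.bijective,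
      ← Matrix.submatrix_mul _ _ _ _ _ e.bijective, Matrix.submatrix_id_id]
    exact hspec

/-! ### Rotation invariance and the mean error -/

theorem stdNormal_map_curry (n ℓ : ℕ) :
    (stdNormal (Fin n × Fin ℓ)).map (fun x i j => x (i, j)) = gaussianRows n ℓ := by
  have hu : Measurable fun (ω : Fin n → Fin ℓ → ℝ) (q : Fin n × Fin ℓ) => ω q.1 q.2 := by fun_prop
  have hc : Measurable fun (x : Fin n × Fin ℓ → ℝ) (i : Fin n) (j : Fin ℓ) => x (i, j) := by
    fun_prop
  have h : stdNormal (Fin n × Fin ℓ)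
      = (gaussianRows n ℓ).map fun ω (q : Fin n × Fin ℓ) => ω q.1 q.2 := by
    refine Measure.pi_eq fun s hs => ?_
    rw [Measure.map_apply hu (MeasurableSet.univ_pi hs)]
    have : (fun (ω : Fin n → Fin ℓ → ℝ) (q : Fin n × Fin ℓ) => ω q.1 q.2) ⁻¹' (Set.univ.pi s)
        = Set.univ.pi fun i => Set.univ.pi fun j => s (i, j) := by
      ext ω
      simp [Set.mem_pi]
    rw [this, gaussianRows, Measure.pi_pi, Fintype.prod_prod_type]
    refine Finset.prod_congr rfl fun i _ => ?_
    rw [stdNormal, Measure.pi_pi]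
  rw [h, Measure.map_map hc hu]
  exact Measure.map_id

/-- Rotation invariance of a standard Gaussian matrix. -/
theorem IsStandardGaussian.map_rotation {S : Type*} [MeasurableSpace S] {P : Measure S} {n ℓ : ℕ}
    {Om : S → Matrix (Fin n) (Fin ℓ) ℝ} (h : IsStandardGaussian P Om)
    {V : Matrix (Fin n) (Fin n) ℝ} (hV : Vᵀ * V = 1) :
    AEMeasurable (fun s (i : Fin n) (j : Fin ℓ) => (Vᵀ * Om s) i j) P ∧
      P.map (fun s (i : Fin n) (j : Fin ℓ) => (Vᵀ * Om s) i j) = gaussianRows n ℓ := by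
  let f : (Fin n × Fin ℓ → ℝ) →ₗ[ℝ] (Fin n × Fin ℓ → ℝ) :=
    { toFun := fun x q => ∑ k, V k q.1 * x (k, q.2)
      map_add' := fun x y => by
        funext q
        simp [mul_add, Finset.sum_add_distrib]
      map_smul' := fun c x => by
        funext q
        simp only [Pi.smul_apply, smul_eq_mul, RingHom.id_apply, Finset.mul_sum]
        exact Finset.sum_congr rfl fun k _ => by ring }
  have hVV : V * Vᵀ = 1 := mul_eq_one_comm.1 hV
  have hf : ∀ x, ∑ q, f x q ^ 2 = ∑ q, x q ^ 2 := fun x => by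
    rw [Fintype.sum_prod_type_right, Fintype.sum_prod_type_right]
    refine Finset.sum_congr rfl fun j _ => ?_
    have h1 : (Vᵀ *ᵥ fun k => x (k, j)) ⬝ᵥ (Vᵀ *ᵥ fun k => x (k, j))
        = (fun k => x (k, j)) ⬝ᵥ fun k => x (k, j) := by
      rw [Matrix.dotProduct_mulVec, Matrix.vecMul_transpose, Matrix.mulVec_mulVec, hVV,
        Matrix.one_mulVec]
    simp only [dotProduct, ← sq] at h1
    exact h1
  have hX : AEMeasurable (fun s (q : Fin n × Fin ℓ) => Om s q.1 q.2) P :=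
    aemeasurable_pi_iff.2 fun q => (h.1 q.1 q.2).aemeasurable
  have hlaw : P.map (fun s (q : Fin n × Fin ℓ) => Om s q.1 q.2) = stdNormal (Fin n × Fin ℓ) := by
    have := h.2.isProbabilityMeasure
    refine ((iIndepFun_iff_map_fun_eq_pi_map
      fun q : Fin n × Fin ℓ => (h.1 q.1 q.2).aemeasurable).1 h.2).trans ?_
    rw [stdNormal]
    congr 1
    funext q
    exact (h.1 q.1 q.2).map_eq
  have hfm : Measurable f := (LinearMap.continuous_of_finiteDimensional f).measurable
  have hc : Measurable fun (x : Fin n × Fin ℓ → ℝ) (i : Fin n) (j : Fin ℓ) => x (i, j) := by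
    fun_prop
  have heq : (fun s (i : Fin n) (j : Fin ℓ) => (Vᵀ * Om s) i j) =
      ((fun (x : Fin n × Fin ℓ → ℝ) (i : Fin n) (j : Fin ℓ) => x (i, j)) ∘ f) ∘
        fun s (q : Fin n × Fin ℓ) => Om s q.1 q.2 := by
    funext s i j
    simp [f, Matrix.mul_apply]
  rw [heq]
  refine ⟨(hc.comp hfm).comp_aemeasurable hX, ?_⟩
  rw [← AEMeasurable.map_map_of_aemeasurable (hc.comp hfm).aemeasurable hX, hlaw,
    ← Measure.map_map hc hfm, stdNormal_map_linear f hf, stdNormal_map_curry]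

theorem topRows_mul_rightInv {n r ℓ : ℕ} (h : r ≤ n) {ω : Fin n → Fin ℓ → ℝ}
    (hω : LinearIndependent ℝ (topRows h ω).row) : topRows h ω * rightInv (topRows h ω) = 1 := by
  rw [rightInv, ← Matrix.mul_assoc, Matrix.mul_nonsing_inv _ ((isUnit_det_gram_iff _).2 hω)]

theorem sum_Ioc_eig {n : ℕ} (H : Matrix (Fin n) (Fin n) ℝ) (r : ℕ) :
    ∑ j ∈ Finset.Ioc r n, eig H j = ∑ j with r ≤ (j : Fin n).val, eig H (j + 1) := by
  symm
  refine Finset.sum_bij (fun (j : Fin n) _ => (j : ℕ) + 1) ?_ ?_ ?_ ?_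
  · intro j hj
    have := (Finset.mem_filter.1 hj).2
    exact Finset.mem_Ioc.2 ⟨by omega, by omega⟩
  · intro i _ j _ hij
    exact Fin.ext (by omega)
  · intro j hj
    have := Finset.mem_Ioc.1 hj
    exact ⟨⟨j - 1, by omega⟩, Finset.mem_filter.2 ⟨Finset.mem_univ _, by simp only; omega⟩,
      by simp only; omega⟩
  · exact fun _ _ => rfl

/-- The mean error of the truncated Nyström approximation. -/
theorem lintegral_error_le {S : Type*} [MeasurableSpace S] {P : Measure S} [IsProbabilityMeasure P]
    {m n ℓ r k : ℕ} (A : Matrix (Fin m) (Fin n) ℝ) (hrn : r ≤ n) (hrl : r + 2 ≤ ℓ) (hrk : r ≤ k)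
    {Om : S → Matrix (Fin n) (Fin ℓ) ℝ} (hOm : IsStandardGaussian P Om)
    {Hhat : S → Matrix (Fin n) (Fin n) ℝ}
    (hHhat : ∀ᵐ s ∂P, IsNystromOutput (Aᵀ * A) (Om s) k (Hhat s)) :
    (∀ᵐ s ∂P, (Hhat s).PosSemidef ∧ (Aᵀ * A - Hhat s).PosSemidef) ∧
      ∫⁻ s, ENNReal.ofReal ‖Aᵀ * A - Hhat s‖ ∂P ≤ ENNReal.ofReal (eig (Aᵀ * A) (r + 1) +
        (r : ℝ) / ((ℓ : ℝ) - r - 1) * ∑ j ∈ Finset.Ioc r n, eig (Aᵀ * A) j) := by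
  have hH := posSemidef_transpose_mul_self A
  obtain ⟨V, hV, hHV⟩ := exists_diagonalization hH
  obtain ⟨hωm, hωlaw⟩ := hOm.map_rotation hV
  set ω : S → Fin n → Fin ℓ → ℝ := fun s i j => (Vᵀ * Om s) i j with hω
  set d : Fin n → ℝ := fun j => eig (Aᵀ * A) (j + 1) with hd
  have hd0 : ∀ j, 0 ≤ d j := fun j => eig_nonneg hH _
  have hind : ∀ᵐ s ∂P, LinearIndependent ℝ (topRows hrn (ω s)).row := by
    have := ae_linearIndependent_topRows (n := n) r hrn hrl
    rw [← hωlaw] at this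
    exact ae_of_ae_map hωm this
  let F : (Fin n → Fin ℓ → ℝ) → ℝ := fun ω => ∑ j with r ≤ (j : Fin n).val, d j *
        ∑ i, (ω j ⬝ᵥ fun k => rightInv (topRows hrn ω) k i) ^ 2
  have hFm : Measurable F := by
    refine Finset.measurable_sum _ fun j _ => (Finset.measurable_sum _ fun i _ =>
      Measurable.pow_const ?_ 2).const_mul _
    simp only [dotProduct]
    exact Finset.measurable_sum _ fun k _ =>
      Measurable.mul (by fun_prop) (measurable_rightInv_topRows hrn k i)
  have hkey : ∀ᵐ s ∂P, (Hhat s).PosSemidef ∧ (Aᵀ * A - Hhat s).PosSemidef ∧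
      ‖Aᵀ * A - Hhat s‖ ≤ eig (Aᵀ * A) (r + 1) + F (ω s) := by
    filter_upwards [hHhat, hind] with s hs hsi
    have hR := topRows_mul_rightInv hrn hsi
    exact hs.error_bound hrk hrn (by omega) hV hHV (eig_nonneg hH (r + 1)) hd0
      (fun j hj => eig_anti hH (by omega) (by omega)) (fun j hj => eig_anti hH (by omega) (by omega))
      (rightInv (topRows hrn (ω s))) fun i i' =>
        (congrFun (congrFun hR i) i').trans (Matrix.one_apply ..)
  refine ⟨hkey.mono fun s hs => ⟨hs.1, hs.2.1⟩, ?_⟩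
  have hF0 : ∀ ω, 0 ≤ F ω := fun ω => Finset.sum_nonneg fun j _ =>
    mul_nonneg (hd0 j) (Finset.sum_nonneg fun _ _ => sq_nonneg _)
  have hpos : (0 : ℝ) < (ℓ : ℝ) - r - 1 := by
    have : (r : ℝ) + 2 ≤ ℓ := by exact_mod_cast hrl
    linarith
  calc ∫⁻ s, ENNReal.ofReal ‖Aᵀ * A - Hhat s‖ ∂P
      ≤ ∫⁻ s, (ENNReal.ofReal (eig (Aᵀ * A) (r + 1)) + ENNReal.ofReal (F (ω s))) ∂P := by
        refine lintegral_mono_ae (hkey.mono fun s hs => ?_)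
        rw [← ENNReal.ofReal_add (eig_nonneg hH _) (hF0 _)]
        exact ENNReal.ofReal_le_ofReal hs.2.2
    _ = ENNReal.ofReal (eig (Aᵀ * A) (r + 1)) +
          ∫⁻ ω, ENNReal.ofReal (F ω) ∂(gaussianRows n ℓ) := by
        rw [lintegral_add_left measurable_const, lintegral_const, measure_univ, mul_one, ← hωlaw,
          lintegral_map' hFm.ennreal_ofReal.aemeasurable hωm]
    _ ≤ _ := by
        rw [ENNReal.ofReal_add (eig_nonneg hH _)
          (mul_nonneg (by positivity) (Finset.sum_nonneg fun j _ => eig_nonneg hH j)), sum_Ioc_eig]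
        gcongr
        exact lintegral_weighted_sum_sq_le hrn hrl d hd0

/-- Working with the lower integral of `e` means that only `f` has to be measurable. -/
theorem integrable_and_integral_le {S : Type*} [MeasurableSpace S] {P : Measure S}
    [IsProbabilityMeasure P] {f e : S → ℝ} (hf : AEMeasurable f P) {b c : ℝ} (hb : 0 ≤ b)
    (hc : 0 ≤ c) (hf0 : ∀ s, 0 ≤ f s) (hfe : ∀ᵐ s ∂P, f s ≤ c + e s) (he0 : ∀ s, 0 ≤ e s)
    (he : ∫⁻ s, ENNReal.ofReal (e s) ∂P ≤ ENNReal.ofReal b) :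
    Integrable f P ∧ ∫ s, f s ∂P ≤ c + b := by
  have h1 : ∫⁻ s, ENNReal.ofReal (f s) ∂P ≤ ENNReal.ofReal (c + b) := by
    calc ∫⁻ s, ENNReal.ofReal (f s) ∂P
        ≤ ∫⁻ s, (ENNReal.ofReal c + ENNReal.ofReal (e s)) ∂P := by
          refine lintegral_mono_ae (hfe.mono fun s hs => ?_)
          rw [← ENNReal.ofReal_add hc (he0 s)]
          exact ENNReal.ofReal_le_ofReal hs
      _ = ENNReal.ofReal c + ∫⁻ s, ENNReal.ofReal (e s) ∂P := by
          rw [lintegral_add_left measurable_const, lintegral_const, measure_univ, mul_one]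
      _ ≤ _ := by rw [ENNReal.ofReal_add hc hb]; gcongr
  refine ⟨(lintegral_ofReal_ne_top_iff_integrable hf.aestronglyMeasurable
    (Filter.Eventually.of_forall hf0)).1 (h1.trans_lt ENNReal.ofReal_lt_top).ne, ?_⟩
  rw [integral_eq_lintegral_of_nonneg_ae (Filter.Eventually.of_forall hf0)
    hf.aestronglyMeasurable]
  exact ENNReal.toReal_le_of_le_ofReal (by positivity) h1

/-- The bound does not depend on the part of the target rank that exceeds the dimension. -/
theorem lintegral_error_le_Psi {S : Type*} [MeasurableSpace S] {P : Measure S}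
    [IsProbabilityMeasure P] {m n r p k : ℕ} (A : Matrix (Fin m) (Fin n) ℝ) (hp : 2 ≤ p)
    (hrk : r ≤ k) {Om : S → Matrix (Fin n) (Fin (r + p)) ℝ} (hOm : IsStandardGaussian P Om)
    {Hhat : S → Matrix (Fin n) (Fin n) ℝ}
    (hHhat : ∀ᵐ s ∂P, IsNystromOutput (Aᵀ * A) (Om s) k (Hhat s)) :
    (∀ᵐ s ∂P, (Hhat s).PosSemidef ∧ (Aᵀ * A - Hhat s).PosSemidef) ∧
      ∫⁻ s, ENNReal.ofReal ‖Aᵀ * A - Hhat s‖ ∂P ≤ ENNReal.ofReal (Psi (Aᵀ * A) r p) := by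
  by_cases hrn : r ≤ n
  · have h := lintegral_error_le A hrn (by omega) hrk hOm hHhat
    have e : ((r + p : ℕ) : ℝ) - r - 1 = (p : ℝ) - 1 := by push_cast; ring
    rwa [e] at h
  -- For `r > n` the bound is applied with rank `n`: then `λ_{n+1} = 0` and the tail is empty, so it
  -- equals 0, as does `Ψ`.
  · have h := lintegral_error_le A le_rfl (by omega) (by omega : n ≤ k) hOm hHhat
    have e : ∀ j, n ≤ j → eig (Aᵀ * A) (j + 1) = 0 := fun j hj =>
      dif_neg fun h => by have := h.2.2; omega
    rw [e n le_rfl, Finset.Ioc_self, Finset.sum_empty] at h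
    rw [Psi, e r (by omega), Finset.Ioc_eq_empty (by omega), Finset.sum_empty]
    simpa only [mul_zero] using h

theorem Psi_nonneg {n : ℕ} {H : Matrix (Fin n) (Fin n) ℝ} (hH : H.PosSemidef) (r : ℕ) {p : ℕ}
    (hp : 2 ≤ p) : 0 ≤ Psi H r p := by
  have : (2 : ℝ) ≤ p := by exact_mod_cast hp
  exact add_nonneg (eig_nonneg hH _) (mul_nonneg (div_nonneg (Nat.cast_nonneg _) (by linarith))
    (Finset.sum_nonneg fun j _ => eig_nonneg hH j))

end

end GNSketch

theorem theorem2 {S : Type*} [MeasurableSpace S] (P : Measure S) [IsProbabilityMeasure P]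
    {m n : ℕ} (Γ : Matrix (Fin n) (Fin n) ℝ) (hΓ : Γ.PosDef) (G : Matrix (Fin m) (Fin n) ℝ)
    (g : Fin n → ℝ) (hg : g ≠ 0)
    (r p : ℕ) (hp : 2 ≤ p)
    (Om : S → Matrix (Fin n) (Fin (r + p)) ℝ) (hOm : GNSketch.IsStandardGaussian P Om)
    (k : ℕ) (hk : r ≤ k)
    (Hhat : S → Matrix (Fin n) (Fin n) ℝ)
    (hmeas : ∀ i j, AEMeasurable (fun s => Hhat s i j) P)
    (hHhat : ∀ᵐ s ∂P,
      GNSketch.IsNystromOutput (GNSketch.misfitHessian Γ G) (Om s) k (Hhat s)) :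
    let H := GNSketch.misfitHessian Γ G
    let δx := GNSketch.gnStep (GNSketch.gnHessian Γ G) g
    let δxhat := fun s => GNSketch.gnStep (GNSketch.sketchedHessian Γ (Hhat s)) g
    let relErr := fun s => GNSketch.wnorm Γ⁻¹ (δx - δxhat s) / GNSketch.wnorm Γ⁻¹ δx
    let κ := fun s => GNSketch.cond (GNSketch.precondOp H (Hhat s))
    (Integrable relErr P ∧ ∫ s, relErr s ∂P ≤ GNSketch.Psi H r p) ∧
    (Integrable κ P ∧ ∫ s, κ s ∂P ≤ 1 + GNSketch.Psi H r p) := by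

  intro H δx δxhat relErr κ
  have hH : H.PosSemidef := GNSketch.posSemidef_transpose_mul_self _
  obtain ⟨hpsd, hint⟩ := GNSketch.lintegral_error_le_Psi (GNSketch.forwardOp Γ G) hp hk hOm hHhat
  have hPsi := GNSketch.Psi_nonneg hH r hp
  -- Measurable versions of the entries of `Ĥ`; replacing `Ĥ` by them changes the two random
  -- variables only on a null set.
  choose M hM hMae using hmeas
  have hMH : ∀ᵐ s ∂P, Hhat s = Matrix.of fun i j => M i j s := by
    have : ∀ᵐ s ∂P, ∀ i j, Hhat s i j = M i j s :=
      ae_all_iff.2 fun i => ae_all_iff.2 fun j => hMae i j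
    exact this.mono fun s hs => Matrix.ext hs
  have hMm : ∀ i j, Measurable fun s => (Matrix.of fun i j => M i j s) i j := hM
  have hδx : δx = GNSketch.gnStep (GNSketch.sketchedHessian Γ H) g :=
    congrArg (GNSketch.gnStep · g) (GNSketch.gnHessian_eq hΓ G)
  have hrel : AEMeasurable relErr P :=
    ⟨_, GNSketch.measurable_relErr Γ hMm g δx (GNSketch.wnorm Γ⁻¹ δx), hMH.mono fun s hs => by
      simp only [relErr, δxhat]; rw [hs]⟩
  have hκ : AEMeasurable κ P := by
    refine ⟨_, GNSketch.measurable_cond_formula H hMm, ?_⟩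
    filter_upwards [hMH, hpsd] with s hs hs'
    simp only [κ]
    rw [GNSketch.cond_precondOp_eq hH hs'.1, hs]
  refine ⟨?_, ?_⟩
  · have h := GNSketch.integrable_and_integral_le (e := fun s => ‖H - Hhat s‖) hrel hPsi le_rfl
      (fun s => div_nonneg (norm_nonneg _) (norm_nonneg _)) ?_ (fun s => norm_nonneg _) hint
    · rwa [zero_add] at h
    · filter_upwards [hpsd] with s hs
      simp only [relErr, δxhat]
      rw [zero_add, hδx]
      exact GNSketch.relErr_le hΓ hH hs.1 g
  · refine GNSketch.integrable_and_integral_le (e := fun s => ‖H - Hhat s‖) hκ hPsi zero_le_one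
      (fun s => mul_nonneg (norm_nonneg _) (norm_nonneg _)) ?_ (fun s => norm_nonneg _) hint
    filter_upwards [hpsd] with s hs
    exact GNSketch.cond_precondOp_le hs.1 hs.2
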